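/- Let $n\ge 0$, let $A_1,A_0,B_0$ be $2\pi$-periodic $n\times n$ complex matrix functions with entries in $L^2(0,2\pi)$, let $\lambda\in\mathbb C$, and write $\hat f_j=\frac1{2\pi}\int_0^{2\pi}f(x)e^{-ijx}\,dx$. For a Hilbert–Schmidt operator $T$ on a Hilbert space $H$, $\det_2(I-T)$ denotes the common limit of $\det(I-T_J)\,e^{\operatorname{tr}T_J}$ over all increasing sequences of finite-dimensional subspaces $H_J$ with dense union, where $T_J=P_{H_J}T|_{H_J}$. Define, on $2\pi$-periodic $L^2$ functions with values in $\mathbb C^n$, $$K(\lambda)=-\partial_x(\partial_x^2-1)^{-1}A_1-(\partial_x^2-1)^{-1}(A_0+1-\lambda B_0),$$ so that $I-K(\lambda)=(\partial_x^2-1)^{-1}(\partial_x^2+\partial_xA_1+A_0-\lambda B_0)$. Let $$\mathbb A(\lambda)=\begin{pmatrix}0&I\\ \lambda B_0-A_0-(\partial_xA_1)&-A_1\end{pmatrix},\qquad \mathbb K(\lambda)=(\partial_x-1)^{-1}(\mathbb A(\lambda)-1),$$ where $(\partial_xA_1)$ is the distributional derivative of $A_1$. Let $F_J(\lambda)=\det_2(I-\hat{\mathcal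 K}_J(\lambda))$, where $\hat{\mathcal K}_J$ is the matrix with the $2n\times2n$ blocks $(ij-1)^{-1}\big(\widehat{\mathbb A}_{j-k}-\delta_{jk}I\big)$, $|j|,|k|\le J$. Then $K(\lambda)$ is Hilbert–Schmidt and $D(\lambda):=\det_2(I-K(\lambda))$ exists; the limit $F(\lambda):=\lim_{J\to\infty}F_J(\lambda)$ exists; if moreover $\partial_xA_1\in L^2$, then $\mathbb K(\lambda)$ is Hilbert–Schmidt on periodic $L^2$ functions with values in $\mathbb C^{2n}$ and $F(\lambda)=\det_2(I-\mathbb K(\lambda))$. In all cases $$F(\lambda)=\epsilon\,e^{\hat\delta-\delta}\,D(\lambda),$$ where $$\hat\delta=\operatorname{tr}(\hat A_{1,0}+2I)\Big(1+\sum_{j\neq0}\frac1{j^2+ij}\Big),\qquad \delta=\operatorname{tr}(\hat A_{0,0}+I-\lambda\hat B_{0,0})\sum_{j\in\mathbb Z}\frac1{j^2+1},\qquad \epsilon=\lim_{J\to\infty}\prod_{|j|\le J}\Big(1-\frac2{ij+1}\Big)^n .$$ Here $\hat A_{m,0},\hat B_{0,0}$ are the zeroth Fourier coefficients of $A_m,B_0$;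 both series converge absolutely, and the limit defining $\epsilon$ exists. -/

import Mathlib

open Filter Topology MeasureTheory

noncomputable section

namespace PeriodicEvans

/-! ### Second-order regularized determinants -/

section Determinant

universe u

variable {H : Type u} [NormedAddCommGroup H] [InnerProductSpace ℂ H]

/-- `T` is Hilbert--Schmidt: `∑ ‖T e_i‖² < ∞` for an orthonormal basis `e` of `H`
(the sum does not depend on the basis). -/
def IsHilbertSchmidt (T : H →L[ℂ] H) : Prop :=
  ∃ (ι : Type u) (e : HilbertBasis ι ℂ H), Summable fun i => ‖T (e i)‖ ^ 2

/-- The Galerkin approximation `P_V T|_V` of `T` on a finite-dimensional subspace `V`. -/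
def compression (T : H →L[ℂ] H) (V : Submodule ℂ H) [FiniteDimensional ℂ V] : V →L[ℂ] V :=
  V.orthogonalProjectionOnto ∘L T ∘L V.subtypeL

/-- `det₂ (I - S) = det (I - S) * exp (tr S)` for an endomorphism `S` of a
finite-dimensional space. -/
def finiteDet2 {V : Type*} [AddCommGroup V] [Module ℂ V] (S : V →ₗ[ℂ] V) : ℂ :=
  LinearMap.det (1 - S) * Complex.exp (LinearMap.trace ℂ V S)

/-- `T` is Hilbert--Schmidt and `det₂ (I - T) = d`: the regularized determinants of the Galerkin
approximations of `T` converge to `d` along every increasing sequence of finite-dimensional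
subspaces that fills up `H`. -/
def HasDet2 (T : H →L[ℂ] H) (d : ℂ) : Prop :=
  IsHilbertSchmidt T ∧
    ∀ (V : ℕ → Submodule ℂ H) [∀ J, FiniteDimensional ℂ (V J)], Monotone V →
      Dense (⋃ J, (V J : Set H)) →
        Tendsto (fun J => finiteDet2 (compression T (V J) : V J →ₗ[ℂ] V J)) atTop (𝓝 d)

open Classical in
/-- The 2-modified Fredholm determinant `det₂ (I - T)` (with value `0` if it does not exist). -/
def det2 (T : H →L[ℂ] H) : ℂ :=
  if h : ∃ d, HasDet2 T d then h.choose else 0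

/-- On a separable space the value of the determinant is unique. -/
theorem HasDet2.det2_eq [TopologicalSpace.SeparableSpace H] {T : H →L[ℂ] H} {d : ℂ}
    (h : HasDet2 T d) : det2 T = d := by
  have hex : ∃ d, HasDet2 T d := ⟨d, h⟩
  have h' : HasDet2 T (det2 T) := by
    rw [det2, dif_pos hex]
    exact hex.choose_spec
  let x : ℕ → H := TopologicalSpace.denseSeq H
  let V : ℕ → Submodule ℂ H := fun J => Submodule.span ℂ (x '' Set.Iio J)
  have : ∀ J, FiniteDimensional ℂ (V J) := fun J =>
    FiniteDimensional.span_of_finite ℂ ((Set.finite_Iio J).image x)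
  have hm : Monotone V := fun a b hab =>
    Submodule.span_mono (Set.image_mono (Set.Iio_subset_Iio hab))
  have hd : Dense (⋃ J, (V J : Set H)) := by
    refine (TopologicalSpace.denseRange_denseSeq H).mono ?_
    rintro _ ⟨k, rfl⟩
    exact Set.mem_iUnion.2 ⟨k + 1, Submodule.subset_span ⟨k, Nat.lt_succ_self k, rfl⟩⟩
  exact tendsto_nhds_unique (h'.2 V hm hd) (h.2 V hm hd)

end Determinant

/-! ### Periodic functions and Fourier multipliers -/

instance two_pi_pos_fact : Fact (0 < 2 * Real.pi) := ⟨Real.two_pi_pos⟩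

/-- The circle `ℝ / 2πℤ`. -/
abbrev Circ : Type := AddCircle (2 * Real.pi)

/-- Complex `2π`-periodic `L²` functions. The measure is normalized to total mass `1`, so that
`fourierCoeff f j = (1 / 2π) ∫₀^{2π} f(x) e^{-ijx} dx`. -/
abbrev L2 : Type := Lp ℂ 2 (AddCircle.haarAddCircle : Measure Circ)

/-- The Hilbert space of `2π`-periodic `L²` vector functions with components indexed by `ι`. -/
abbrev VecL2 (ι : Type) [Fintype ι] : Type := PiLp 2 fun _ : ι => L2

/-- The constant function `1`. -/
def oneL2 : L2 := Lp.const 2 AddCircle.haarAddCircle (1 : ℂ)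

theorem norm_fourierCoeff_mul_le (m u : L2) (j : ℤ) :
    ‖fourierCoeff (fun x => m x * u x) j‖ ≤ ‖m‖ * ‖u‖ := by
  have h1 : fourierCoeff (fun x => m x * u x) j
      = fourierCoeff ((m • u : Lp ℂ 1 (AddCircle.haarAddCircle : Measure Circ))) j := by
    refine congrFun (fourierCoeff_congr_ae ?_) j
    filter_upwards [Lp.coeFn_lpSMul (r := 1) m u] with x hx
    rw [hx]; rfl
  rw [h1]
  refine le_trans ?_ (Lp.norm_smul_le (r := 1) m u)
  rw [L1.norm_eq_integral_norm, fourierCoeff]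
  refine (norm_integral_le_integral_norm _).trans (le_of_eq ?_)
  refine integral_congr_ae (Eventually.of_forall fun x => ?_)
  simp only [norm_smul, fourier_apply, Circle.norm_coe, one_mul]

theorem integrable_mul_L2 (m u : L2) :
    Integrable (fun x => m x * u x) (AddCircle.haarAddCircle : Measure Circ) :=
  (Lp.memLp m).integrable_mul (Lp.memLp u)

theorem memlp_filter (s : lp (fun _ : ℤ => ℂ) 2) (m u : L2) :
    Memℓp (fun j : ℤ => s j * fourierCoeff (fun x => m x * u x) j) 2 := by
  have hs : Memℓp (((‖m‖ * ‖u‖ : ℝ) : ℂ) • fun j => s j) 2 := (lp.memℓp s).const_smul _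
  refine hs.mono' fun j => ?_
  rw [Pi.smul_apply, smul_eq_mul, norm_mul, norm_mul, mul_comm, Complex.norm_real,
    Real.norm_of_nonneg (by positivity)]
  exact mul_le_mul_of_nonneg_right (norm_fourierCoeff_mul_le m u j) (norm_nonneg _)

/-- The operator `u ↦ s(D) (m u)` on scalar `L²` functions: multiplication by the `L²` function
`m`, followed by the Fourier multiplier with square-summable symbol `s`, so that the `j`-th
Fourier coefficient of the result is `s j` times that of the integrable function `m u`. -/
def scalarOp (s : lp (fun _ : ℤ => ℂ) 2) (m : L2) : L2 →L[ℂ] L2 :=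
  LinearMap.mkContinuous
    { toFun := fun u => fourierBasis.repr.symm
        ⟨fun j => s j * fourierCoeff (fun x => m x * u x) j, memlp_filter s m u⟩
      map_add' := by
        intro u v
        rw [← map_add]
        congr 1
        ext j
        have h : fourierCoeff (fun x => m x * (u + v : L2) x) j
            = fourierCoeff (fun x => m x * u x) j + fourierCoeff (fun x => m x * v x) j := by
          have h2 := congrFun
            (fourierCoeff.add (integrable_mul_L2 m u) (integrable_mul_L2 m v)) j
          rw [Pi.add_apply] at h2
          rw [← h2]
          refine congrFun (fourierCoeff_congr_ae ?_) j
          filter_upwards [Lp.coeFn_add u v] with x hx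
          simp only [hx, Pi.add_apply, mul_add]
        simp only [lp.coeFn_add, Pi.add_apply, h, mul_add]
      map_smul' := by
        intro c u
        rw [RingHom.id_apply, ← map_smul]
        congr 1
        ext j
        have h : fourierCoeff (fun x => m x * (c • u : L2) x) j
            = c * fourierCoeff (fun x => m x * u x) j := by
          rw [← fourierCoeff.const_mul]
          refine congrFun (fourierCoeff_congr_ae ?_) j
          filter_upwards [Lp.coeFn_smul c u] with x hx
          simp only [hx, Pi.smul_apply, smul_eq_mul]
          ring
        simp only [lp.coeFn_smul, Pi.smul_apply, h, smul_eq_mul]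
        ring }
    (‖m‖ * ‖s‖) (by
      intro u
      simp only [LinearMap.coe_mk, AddHom.coe_mk, LinearIsometryEquiv.norm_map]
      have h : ‖(⟨fun j => s j * fourierCoeff (fun x => m x * u x) j, memlp_filter s m u⟩ :
          lp (fun _ : ℤ => ℂ) 2)‖ ≤ ‖((‖m‖ * ‖u‖ : ℝ) : ℂ) • s‖ := by
        refine lp.norm_mono (by norm_num) fun j => ?_
        rw [lp.coeFn_smul, Pi.smul_apply, smul_eq_mul, norm_mul, norm_mul, mul_comm,
          Complex.norm_real, Real.norm_of_nonneg (by positivity)]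
        exact mul_le_mul_of_nonneg_right (norm_fourierCoeff_mul_le m u j) (norm_nonneg _)
      refine h.trans (le_of_eq ?_)
      rw [norm_smul, Complex.norm_real, Real.norm_of_nonneg (by positivity)]
      ring)

theorem fourierCoeff_scalarOp (s : lp (fun _ : ℤ => ℂ) 2) (m u : L2) (j : ℤ) :
    fourierCoeff (scalarOp s m u) j = s j * fourierCoeff (fun x => m x * u x) j := by
  rw [← fourierBasis_repr]
  simp [scalarOp]

/-- The operator `U ↦ s(D) (M U)` on vector functions, for a matrix `M` of `L²` functions:
`(s(D) (M U))_a = ∑_b s(D) (M_{ab} U_b)`. -/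
def vecOp {ι : Type} [Fintype ι] (s : lp (fun _ : ℤ => ℂ) 2) (M : Matrix ι ι L2) :
    VecL2 ι →L[ℂ] VecL2 ι :=
  (PiLp.continuousLinearEquiv 2 ℂ fun _ : ι => L2).symm.toContinuousLinearMap ∘L
    ContinuousLinearMap.pi fun a => ∑ b, scalarOp s (M a b) ∘L PiLp.proj 2 (fun _ : ι => L2) b

theorem vecOp_apply {ι : Type} [Fintype ι] (s : lp (fun _ : ℤ => ℂ) 2) (M : Matrix ι ι L2)
    (U : VecL2 ι) (a : ι) : vecOp s M U a = ∑ b, scalarOp s (M a b) (U b) := by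
  simp [vecOp]

theorem summable_symbol : Summable fun j : ℤ => 1 / ((j : ℝ) ^ 2 + 1) := by
  have h : Summable fun j : ℤ => 1 / (j : ℝ) ^ 2 :=
    Real.summable_one_div_int_pow.2 (by norm_num)
  have h0 : Summable fun j : ℤ => if j = 0 then (1 : ℝ) else 0 :=
    (hasSum_ite_eq (0 : ℤ) (1 : ℝ)).summable
  refine (h.add h0).of_nonneg_of_le (fun j => by positivity) fun j => ?_
  by_cases hj : j = 0
  · simp [hj]
  · have : (0 : ℝ) < (j : ℝ) ^ 2 := by positivity
    simp only [hj, if_false, add_zero]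
    gcongr
    linarith

theorem memlp_symbol {s : ℤ → ℂ} (h : ∀ j : ℤ, ‖s j‖ ^ 2 ≤ 1 / ((j : ℝ) ^ 2 + 1)) :
    Memℓp s 2 := by
  refine memℓp_gen ?_
  simp only [ENNReal.toReal_ofNat, Real.rpow_two]
  exact summable_symbol.of_nonneg_of_le (fun j => by positivity) h

/-- The symbol `ij / ((ij)² - 1)` of `∂ₓ (∂ₓ² - 1)⁻¹`. -/
def symbolDR : lp (fun _ : ℤ => ℂ) 2 :=
  ⟨fun j => (Complex.I * j) / ((Complex.I * j) ^ 2 - 1), memlp_symbol fun j => by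
    have h : (Complex.I * (j : ℂ)) ^ 2 - 1 = -(((j : ℝ) ^ 2 + 1 : ℝ) : ℂ) := by
      rw [mul_pow, Complex.I_sq]; push_cast; ring
    rw [h, norm_div, norm_neg, Complex.norm_real, norm_mul, Complex.norm_I, one_mul,
      Complex.norm_intCast, Real.norm_of_nonneg (by positivity), div_pow, sq_abs,
      div_le_div_iff₀ (by positivity) (by positivity)]
    nlinarith [sq_nonneg (j : ℝ)]⟩

/-- The symbol `1 / ((ij)² - 1)` of `(∂ₓ² - 1)⁻¹`. -/
def symbolR : lp (fun _ : ℤ => ℂ) 2 :=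
  ⟨fun j => 1 / ((Complex.I * j) ^ 2 - 1), memlp_symbol fun j => by
    have h : (Complex.I * (j : ℂ)) ^ 2 - 1 = -(((j : ℝ) ^ 2 + 1 : ℝ) : ℂ) := by
      rw [mul_pow, Complex.I_sq]; push_cast; ring
    rw [h, norm_div, norm_neg, Complex.norm_real, norm_one,
      Real.norm_of_nonneg (by positivity), div_pow,
      div_le_div_iff₀ (by positivity) (by positivity)]
    nlinarith [sq_nonneg (j : ℝ)]⟩

/-- The symbol `1 / (ij - 1)` of `(∂ₓ - 1)⁻¹`. -/
def symbolR1 : lp (fun _ : ℤ => ℂ) 2 :=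
  ⟨fun j => 1 / (Complex.I * j - 1), memlp_symbol fun j => by
    have h : ‖Complex.I * (j : ℂ) - 1‖ ^ 2 = (j : ℝ) ^ 2 + 1 := by
      rw [← Complex.normSq_eq_norm_sq, Complex.normSq_apply]
      simp
      ring
    rw [norm_div, div_pow, h, norm_one, one_pow]⟩

/-! ### The Evans functions -/

section Evans

variable {n : ℕ}

/-- The identity matrix as a (constant) matrix of `L²` functions. -/
def oneMat (n : ℕ) : Matrix (Fin n) (Fin n) L2 := Matrix.diagonal fun _ => oneL2

/-- The matrix of `m`-th Fourier coefficients. -/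
def coeffMat (A : Matrix (Fin n) (Fin n) L2) (m : ℤ) : Matrix (Fin n) (Fin n) ℂ :=
  Matrix.of fun a b => fourierCoeff (A a b) m

/-- The second-order Birman--Schwinger operator `K(λ)`, for which
`I - K(λ) = (∂ₓ² - 1)⁻¹ (∂ₓ² + ∂ₓ A₁ + A₀ - λ B₀)`, that is,
`K(λ) = - ∂ₓ (∂ₓ² - 1)⁻¹ A₁ - (∂ₓ² - 1)⁻¹ (A₀ + 1 - λ B₀)`. -/
def birmanSchwinger (A₁ A₀ B₀ : Matrix (Fin n) (Fin n) L2) (lam : ℂ) :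
    VecL2 (Fin n) →L[ℂ] VecL2 (Fin n) :=
  -vecOp symbolDR A₁ - vecOp symbolR (A₀ + oneMat n - lam • B₀)

/-- The Birman--Schwinger Evans function `D(λ) = det₂ (I - K(λ))`. -/
def evansD (A₁ A₀ B₀ : Matrix (Fin n) (Fin n) L2) (lam : ℂ) : ℂ :=
  det2 (birmanSchwinger A₁ A₀ B₀ lam)

/-- `A'` is the (periodic, weak) derivative of `A`, tested against the trigonometric functions
`e^{-imx}`. -/
def IsWeakDeriv (A A' : Matrix (Fin n) (Fin n) L2) : Prop :=
  ∀ a b, ∀ m : ℤ, fourierCoeff (A' a b) m = Complex.I * m * fourierCoeff (A a b) m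

/-- The first-order Birman--Schwinger operator `𝕂(λ) = (∂ₓ - 1)⁻¹ (𝔸(λ) - 1)` with
`𝔸(λ) = [0, I; λ B₀ - A₀ - A₁', -A₁]`, where `A₁'` is the derivative of `A₁`. -/
def firstOrderBS (A₁ A₁' A₀ B₀ : Matrix (Fin n) (Fin n) L2) (lam : ℂ) :
    VecL2 (Fin n ⊕ Fin n) →L[ℂ] VecL2 (Fin n ⊕ Fin n) :=
  vecOp symbolR1 (Matrix.fromBlocks (-oneMat n) (oneMat n)
    (lam • B₀ - A₀ - A₁') (-A₁ - oneMat n))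

/-- The `m`-th Fourier coefficient of `𝔸(λ) = [0, I; λ B₀ - A₀ - ∂ₓA₁, -A₁]`. The distributional
derivative `∂ₓA₁` has the coefficients `im Â₁(m)`, for every `A₁` in `L²`. -/
def systemCoeff (A₁ A₀ B₀ : Matrix (Fin n) (Fin n) L2) (lam : ℂ) (m : ℤ) :
    Matrix (Fin n ⊕ Fin n) (Fin n ⊕ Fin n) ℂ :=
  Matrix.fromBlocks 0 (if m = 0 then 1 else 0)
    (lam • coeffMat B₀ m - coeffMat A₀ m - (Complex.I * m) • coeffMat A₁ m) (-coeffMat A₁ m)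

/-- The Fourier truncation of `𝕂(λ)` at wave number `J`: the entries of its Fourier matrix
`𝕂_{jk} = (ij - 1)⁻¹ (𝔸̂_{j-k} - δ_{jk} I)` with `|j|, |k| ≤ J`. -/
def firstOrderTrunc (A₁ A₀ B₀ : Matrix (Fin n) (Fin n) L2) (lam : ℂ) (J : ℕ) :
    Matrix (Finset.Icc (-(J : ℤ)) J × (Fin n ⊕ Fin n))
      (Finset.Icc (-(J : ℤ)) J × (Fin n ⊕ Fin n)) ℂ :=
  Matrix.of fun p q => 1 / (Complex.I * (p.1 : ℤ) - 1) *
    (systemCoeff A₁ A₀ B₀ lam ((p.1 : ℤ) - (q.1 : ℤ)) p.2 q.2 - if p = q then 1 else 0)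

/-- The truncated first-order Evans function `F_J(λ) = det₂ (I - 𝕂_J(λ))`. -/
def evansFTrunc (A₁ A₀ B₀ : Matrix (Fin n) (Fin n) L2) (lam : ℂ) (J : ℕ) : ℂ :=
  finiteDet2 (Matrix.toLin' (firstOrderTrunc A₁ A₀ B₀ lam J))

/-- The first-order Birman--Schwinger Evans function `F(λ) = det₂ (I - 𝕂(λ))`, as the limit of
the determinants of the Fourier truncations; this makes sense for `A₁` in `L²`, also when `𝕂(λ)`
is not a Hilbert--Schmidt operator because `A₁` has no square-integrable derivative. -/
def evansF (A₁ A₀ B₀ : Matrix (Fin n) (Fin n) L2) (lam : ℂ) : ℂ :=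
  limUnder atTop (evansFTrunc A₁ A₀ B₀ lam)

/-- `δ̂ = tr (Â₁(0) + 2 I) (1 + ∑_{j ≠ 0} 1 / (j² + ij))`. -/
def deltaHat (A₁ : Matrix (Fin n) (Fin n) L2) : ℂ :=
  (coeffMat A₁ 0 + (2 : ℂ) • (1 : Matrix (Fin n) (Fin n) ℂ)).trace *
    (1 + ∑' j : {j : ℤ // j ≠ 0}, 1 / (((j : ℤ) : ℂ) ^ 2 + Complex.I * (j : ℤ)))

/-- `δ(λ) = tr (Â₀(0) + I - λ B̂₀(0)) ∑_j 1 / (j² + 1)`. -/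
def delta (A₀ B₀ : Matrix (Fin n) (Fin n) L2) (lam : ℂ) : ℂ :=
  (coeffMat A₀ 0 + 1 - lam • coeffMat B₀ 0).trace * ∑' j : ℤ, 1 / ((j : ℂ) ^ 2 + 1)

/-- The partial products `∏_{|j| ≤ J} (1 - 2 / (ij + 1))ⁿ`. -/
def epsilonTrunc (n J : ℕ) : ℂ :=
  ∏ j ∈ Finset.Icc (-(J : ℤ)) J, (1 - 2 / (Complex.I * j + 1)) ^ n

/-- `ε = lim_{J → ∞} ∏_{|j| ≤ J} (1 - 2 / (ij + 1))ⁿ`. -/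
def epsilon (n : ℕ) : ℂ := limUnder atTop (epsilonTrunc n)

end Evans

end PeriodicEvans

end

/-!
The relation between the two Evans functions already holds for the Fourier truncations. Write `D`
for the diagonal matrix of the `ij` with `|j| ≤ J`, and `A₁, A₀, B₀` for the truncated block
Toeplitz matrices. In the truncation of the first-order operator the derivative of `A₁` is the
commutator `D A₁ - A₁ D`, so that eliminating one block of `D - 𝔸` leaves the second-order pencil
`D² + D A₁ + A₀ - λ B₀` (`det_companion`). The truncation of `I - K(λ)` is the same pencil
multiplied by `(D² - 1)⁻¹` in place of `(D - 1)⁻²`, and the two preconditioners differ in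
determinant by the partial product of `ε`, which is `(-1)ⁿ` for every `J` (`det_one_sub_firstOrderTrunc`,
`epsilonTrunc_eq`). The traces in the regularizing factors are multiples of `∑ 1 / (j² + 1)` over
`|j| ≤ J` and converge to `δ̂` and `δ`.

It remains to know that `det₂ (I - T)` exists for a Hilbert--Schmidt operator `T` as the limit along
every exhausting sequence of subspaces (`IsHilbertSchmidt.exists_hasDet2`). On finite-dimensional
spaces, the arithmetic-geometric mean inequality for the eigenvalues of `(1 - A)ᴴ (1 - A)` gives
Carleman's bound `|det₂ (I - A)| ≤ exp (‖A‖² / 2)` in the Frobenius norm (`norm_matDet2_le`), and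
the Schwarz lemma on complex lines turns it into local Lipschitz continuity in that norm
(`norm_matDet2_sub_le`). Two Galerkin approximations of `T` are compared on the sum of their
subspaces, where both are close to `T` in the Hilbert--Schmidt norm. Thus the determinants of all
exhausting sequences are Cauchy with a common limit. That `K(λ)` and `𝕂(λ)` are Hilbert--Schmidt is
read off their Fourier matrices, with entries `s j * M̂(j - k)` for square-summable `s` and `M̂`
(`inner_vecOp`, `summable_norm_sq_vecOp`).
-/

namespace PeriodicEvans

/-! ### The regularized determinant of a matrix -/

section MatrixDet

variable {m : Type*} [Fintype m] [DecidableEq m]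

/-- `det₂ (I - A) = det (I - A) * exp (tr A)` for a complex matrix `A`. -/
noncomputable def matDet2 (A : Matrix m m ℂ) : ℂ := (1 - A).det * Complex.exp A.trace

theorem finiteDet2_eq_matDet2 {V : Type*} [AddCommGroup V] [Module ℂ V] (b : Module.Basis m ℂ V)
    (S : V →ₗ[ℂ] V) : finiteDet2 S = matDet2 (LinearMap.toMatrix b b S) := by
  rw [finiteDet2, matDet2, ← LinearMap.det_toMatrix b, LinearMap.trace_eq_matrix_trace ℂ b,
    map_sub, LinearMap.toMatrix_one]

theorem finiteDet2_toLin' (A : Matrix m m ℂ) : finiteDet2 (Matrix.toLin' A) = matDet2 A := by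
  rw [finiteDet2_eq_matDet2 (Pi.basisFun ℂ m), LinearMap.toMatrix_eq_toMatrix',
    LinearMap.toMatrix'_toLin']

/-- The regularized determinant does not see the order of a composition, so that it may be
computed on any space that contains the range. -/
theorem finiteDet2_comp_comm {V U : Type*} [AddCommGroup V] [Module ℂ V] [FiniteDimensional ℂ V]
    [AddCommGroup U] [Module ℂ U] [FiniteDimensional ℂ U] (A : V →ₗ[ℂ] U) (B : U →ₗ[ℂ] V) :
    finiteDet2 (A ∘ₗ B) = finiteDet2 (B ∘ₗ A) := by
  classical
  let b := Module.finBasis ℂ V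
  let c := Module.finBasis ℂ U
  rw [finiteDet2_eq_matDet2 b, finiteDet2_eq_matDet2 c, matDet2, matDet2,
    LinearMap.toMatrix_comp c b c, LinearMap.toMatrix_comp b c b, Matrix.det_one_sub_mul_comm,
    Matrix.trace_mul_comm]

open scoped ComplexOrder in
/-- The arithmetic-geometric mean inequality in exponential form: `t ≤ exp (t - 1)` for each
eigenvalue. -/
theorem norm_det_le_exp_of_posSemidef {M : Matrix m m ℂ} (hM : M.PosSemidef) :
    ‖M.det‖ ≤ Real.exp (M.trace.re - Fintype.card m) := by
  rw [hM.1.det_eq_prod_eigenvalues, hM.1.trace_eq_sum_eigenvalues, norm_prod]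
  have h : (∑ i, (hM.1.eigenvalues i : ℂ)).re - (Fintype.card m : ℝ)
      = ∑ i, (hM.1.eigenvalues i - 1) := by
    rw [Finset.sum_sub_distrib]; simp
  erw [h]
  rw [Real.exp_sum]
  refine Finset.prod_le_prod (fun _ _ => norm_nonneg _) fun i _ => ?_
  have := Real.add_one_le_exp (hM.1.eigenvalues i - 1)
  have h0 := hM.eigenvalues_nonneg i
  simp only [abs_of_nonneg h0, Complex.coe_algebraMap, Complex.norm_real, Real.norm_eq_abs]
  linarith

open scoped ComplexOrder in
/-- Carleman's inequality `|det₂ (I - A)| ≤ exp (‖A‖² / 2)` in the Frobenius norm. -/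
theorem norm_matDet2_le (A : Matrix m m ℂ) :
    ‖matDet2 A‖ ≤ Real.exp ((∑ i, ∑ j, ‖A i j‖ ^ 2) / 2) := by
  have hps := Matrix.posSemidef_conjTranspose_mul_self (1 - A)
  have h := norm_det_le_exp_of_posSemidef hps
  have htr : (Matrix.trace ((1 - A).conjTranspose * (1 - A))).re - Fintype.card m
      = ∑ i, ∑ j, ‖A i j‖ ^ 2 - 2 * A.trace.re := by
    have h1 : (A.conjTranspose * A).trace.re = ∑ i, ∑ j, ‖A i j‖ ^ 2 := by
      rw [Finset.sum_comm]
      simp only [Matrix.trace, Matrix.diag, Matrix.mul_apply, Matrix.conjTranspose_apply,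
        Complex.re_sum]
      refine Finset.sum_congr rfl fun i _ => Finset.sum_congr rfl fun j _ => ?_
      rw [← Complex.normSq_eq_norm_sq, RCLike.star_def, ← Complex.normSq_eq_conj_mul_self,
        Complex.ofReal_re]
    rw [Matrix.conjTranspose_sub, Matrix.conjTranspose_one, sub_mul, one_mul, mul_sub, mul_one,
      Matrix.trace_sub, Matrix.trace_sub, Matrix.trace_sub, Matrix.trace_one,
      Matrix.trace_conjTranspose, Complex.sub_re, Complex.sub_re, Complex.sub_re, h1]
    simp
    ring
  rw [htr, Matrix.det_mul, Matrix.det_conjTranspose, norm_mul, norm_star, ← sq] at h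
  rw [matDet2, norm_mul, Complex.norm_exp]
  refine le_of_sq_le_sq ?_ (Real.exp_pos _).le
  calc _ = ‖(1 - A).det‖ ^ 2 * Real.exp (2 * A.trace.re) := by
        rw [mul_pow, ← Real.exp_nat_mul]; norm_num
    _ ≤ Real.exp (∑ i, ∑ j, ‖A i j‖ ^ 2 - 2 * A.trace.re) * Real.exp (2 * A.trace.re) := by gcongr
    _ = _ := by
      rw [← Real.exp_add, ← Real.exp_nat_mul]
      congr 1
      push_cast
      ring

theorem differentiable_matDet2_line (A B : Matrix m m ℂ) :
    Differentiable ℂ fun z : ℂ => matDet2 (A + z • B) := by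
  simp only [matDet2, Matrix.det_apply, Matrix.trace, Matrix.diag, Matrix.add_apply,
    Matrix.sub_apply, Matrix.smul_apply, smul_eq_mul]
  fun_prop

/-- Local Lipschitz continuity of `det₂` in the Frobenius norm, from Carleman's inequality and the
Schwarz lemma for `z ↦ det₂ (I - A - z (B - A))` on the disc of radius `1 / r`. -/
theorem norm_matDet2_sub_le {A B : Matrix m m ℂ} {M r : ℝ} (hr : 0 < r) (hr1 : r < 1)
    (hA : ∑ i, ∑ j, ‖A i j‖ ^ 2 ≤ M) (hB : ∑ i, ∑ j, ‖(B - A) i j‖ ^ 2 ≤ r ^ 2) :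
    ‖matDet2 B - matDet2 A‖ ≤ 2 * Real.exp (M + 1) * r := by
  have hbd : ∀ z ∈ Metric.ball (0 : ℂ) (1 / r),
      ‖matDet2 (A + z • (B - A))‖ ≤ Real.exp (M + 1) := by
    intro z hz
    refine (norm_matDet2_le _).trans (Real.exp_le_exp.2 ?_)
    have hz' : ‖z‖ ≤ 1 / r := (mem_ball_zero_iff.1 hz).le
    have h1 : ∑ i, ∑ j, ‖(A + z • (B - A)) i j‖ ^ 2
        ≤ ∑ i, ∑ j, (2 * ‖A i j‖ ^ 2 + 2 * ‖z‖ ^ 2 * ‖(B - A) i j‖ ^ 2) := by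
      refine Finset.sum_le_sum fun i _ => Finset.sum_le_sum fun j _ => ?_
      have h2 : ‖(A + z • (B - A)) i j‖ ≤ ‖A i j‖ + ‖z‖ * ‖(B - A) i j‖ := by
        rw [Matrix.add_apply, Matrix.smul_apply, smul_eq_mul, ← norm_mul]
        exact norm_add_le _ _
      have h3 := pow_le_pow_left₀ (norm_nonneg _) h2 2
      nlinarith [sq_nonneg (‖A i j‖ - ‖z‖ * ‖(B - A) i j‖)]
    simp only [Finset.sum_add_distrib, ← Finset.mul_sum] at h1
    -- `|z| < 1 / r` compensates the size `r` of `B - A`, so the bound stays uniform on the disc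
    have h4 : ‖z‖ ^ 2 * ∑ i, ∑ j, ‖(B - A) i j‖ ^ 2 ≤ (1 / r) ^ 2 * r ^ 2 := by gcongr
    have h5 : (1 / r) ^ 2 * r ^ 2 = 1 := by field_simp
    linarith
  have h0 : matDet2 (A + (0 : ℂ) • (B - A)) = matDet2 A := by simp
  have h1 : matDet2 (A + (1 : ℂ) • (B - A)) = matDet2 B := by simp
  have hmaps : Set.MapsTo (fun z : ℂ => matDet2 (A + z • (B - A))) (Metric.ball 0 (1 / r))
      (Metric.closedBall (matDet2 (A + (0 : ℂ) • (B - A))) (2 * Real.exp (M + 1))) := by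
    intro z hz
    have h0b := hbd 0 (Metric.mem_ball_self (by positivity))
    rw [mem_closedBall_iff_norm]
    refine (norm_sub_le _ _).trans ?_
    linarith [hbd z hz]
  have hS := Complex.dist_le_div_mul_dist_of_mapsTo_ball
    (differentiable_matDet2_line A (B - A)).differentiableOn hmaps
    (z := 1) (by rw [mem_ball_zero_iff, norm_one, lt_div_iff₀ hr]; linarith)
  rw [h0, h1, dist_eq_norm, dist_eq_norm, sub_zero, norm_one, mul_one] at hS
  refine hS.trans (le_of_eq ?_)
  field_simp

theorem sum_norm_sq_toMatrix {U : Type*} [NormedAddCommGroup U] [InnerProductSpace ℂ U]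
    (b : OrthonormalBasis m ℂ U) (S : U →ₗ[ℂ] U) :
    ∑ i, ∑ j, ‖LinearMap.toMatrix b.toBasis b.toBasis S i j‖ ^ 2 = ∑ j, ‖S (b j)‖ ^ 2 := by
  rw [Finset.sum_comm]
  refine Finset.sum_congr rfl fun j _ => ?_
  rw [← b.sum_sq_norm_inner_right]
  refine Finset.sum_congr rfl fun i _ => ?_
  rw [LinearMap.toMatrix_apply, OrthonormalBasis.coe_toBasis,
    OrthonormalBasis.coe_toBasis_repr_apply, b.repr_apply_apply]

/-- `norm_matDet2_sub_le` in terms of the Hilbert--Schmidt norm. -/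
theorem norm_finiteDet2_sub_le {U : Type*} [NormedAddCommGroup U] [InnerProductSpace ℂ U]
    (b : OrthonormalBasis m ℂ U) {S S' : U →ₗ[ℂ] U} {M r : ℝ} (hr : 0 < r) (hr1 : r < 1)
    (hS : ∑ i, ‖S (b i)‖ ^ 2 ≤ M) (hS' : ∑ i, ‖S' (b i) - S (b i)‖ ^ 2 ≤ r ^ 2) :
    ‖finiteDet2 S' - finiteDet2 S‖ ≤ 2 * Real.exp (M + 1) * r := by
  rw [finiteDet2_eq_matDet2 b.toBasis, finiteDet2_eq_matDet2 b.toBasis]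
  refine norm_matDet2_sub_le hr hr1 ?_ ?_
  · rwa [sum_norm_sq_toMatrix]
  · rw [← map_sub, sum_norm_sq_toMatrix]
    exact hS'

end MatrixDet

/-! ### Hilbert--Schmidt sums -/

section HilbertSchmidt

universe u

variable {H : Type u} [NormedAddCommGroup H] [InnerProductSpace ℂ H]

theorem _root_.HilbertBasis.hasSum_norm_sq_inner {ι : Type*} (e : HilbertBasis ι ℂ H) (x : H) :
    HasSum (fun i => ‖inner ℂ (e i) x‖ ^ 2) (‖x‖ ^ 2) := by
  have h : HasSum (fun i => ‖e.repr x i‖ ^ (2 : ENNReal).toReal)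
      (‖e.repr x‖ ^ (2 : ENNReal).toReal) := lp.hasSum_norm (by norm_num) (e.repr x)
  simpa only [ENNReal.toReal_ofNat, Real.rpow_two, LinearIsometryEquiv.norm_map,
    e.repr_apply_apply] using h

section Complete

variable [CompleteSpace H]

/-- The Hilbert--Schmidt sums of `T` and of its adjoint in a Hilbert basis agree: both are the sum
of the squared matrix entries. -/
theorem hasSum_norm_sq_adjoint {ι : Type*} (e : HilbertBasis ι ℂ H) {T : H →L[ℂ] H}
    (hT : Summable fun i => ‖T (e i)‖ ^ 2) :
    HasSum (fun i => ‖T.adjoint (e i)‖ ^ 2) (∑' i, ‖T (e i)‖ ^ 2) := by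
  have hrow (i : ι) : HasSum (fun k => ‖inner ℂ (e k) (T (e i))‖ ^ 2) (‖T (e i)‖ ^ 2) :=
    e.hasSum_norm_sq_inner _
  have hcol (k : ι) : HasSum (fun i => ‖inner ℂ (e k) (T (e i))‖ ^ 2)
      (‖T.adjoint (e k)‖ ^ 2) := by
    refine (e.hasSum_norm_sq_inner (T.adjoint (e k))).congr_fun ?_
    intro i
    rw [← T.adjoint_inner_left, ← inner_conj_symm, RCLike.norm_conj]
  have hp : Summable fun p : ι × ι => ‖inner ℂ (e p.2) (T (e p.1))‖ ^ 2 := by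
    rw [summable_prod_of_nonneg fun p => by positivity]
    exact ⟨fun i => (hrow i).summable, by simpa only [(hrow _).tsum_eq] using hT⟩
  have hs := hp.prod_symm.prod
  have hc := Summable.tsum_comm (f := fun i k => ‖inner ℂ (e k) (T (e i))‖ ^ 2) hp
  simp only [(hrow _).tsum_eq, (hcol _).tsum_eq] at hc
  rw [← hc]
  refine Summable.hasSum ?_
  simpa only [Prod.swap_prod_mk, (hcol _).tsum_eq] using hs

/-- The Hilbert--Schmidt sum over a finite orthonormal family is at most that of the adjoint over a
Hilbert basis, by Bessel's inequality in each row of the matrix. -/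
theorem sum_norm_sq_le_tsum_adjoint {ι m : Type*} [Fintype m] (e : HilbertBasis ι ℂ H)
    {f : m → H} (hf : Orthonormal ℂ f) {T : H →L[ℂ] H}
    (hT : Summable fun i => ‖T.adjoint (e i)‖ ^ 2) :
    ∑ k, ‖T (f k)‖ ^ 2 ≤ ∑' i, ‖T.adjoint (e i)‖ ^ 2 := by
  have h : HasSum (fun i => ∑ k, ‖inner ℂ (e i) (T (f k))‖ ^ 2) (∑ k, ‖T (f k)‖ ^ 2) :=
    hasSum_sum fun k _ => e.hasSum_norm_sq_inner _
  refine hasSum_le (fun i => ?_) h hT.hasSum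
  refine le_trans (le_of_eq (Finset.sum_congr rfl fun k _ => ?_))
    (hf.sum_inner_products_le (T.adjoint (e i)) (s := Finset.univ))
  rw [← T.adjoint_inner_left, ← inner_conj_symm, RCLike.norm_conj]

theorem sum_norm_sq_le_tsum {ι m : Type*} [Fintype m] (e : HilbertBasis ι ℂ H)
    {f : m → H} (hf : Orthonormal ℂ f) {T : H →L[ℂ] H}
    (hT : Summable fun i => ‖T (e i)‖ ^ 2) :
    ∑ k, ‖T (f k)‖ ^ 2 ≤ ∑' i, ‖T (e i)‖ ^ 2 := by
  have h := hasSum_norm_sq_adjoint e hT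
  exact (sum_norm_sq_le_tsum_adjoint e hf h.summable).trans_eq h.tsum_eq

end Complete

/-! ### Galerkin approximations -/

/-- The squared Hilbert--Schmidt distance of `T` and `P_V T`. -/
noncomputable def projDefect {ι : Type*} (e : HilbertBasis ι ℂ H) (T : H →L[ℂ] H)
    (V : Submodule ℂ H) [FiniteDimensional ℂ V] : ℝ :=
  ∑' i, ‖T (e i) - V.starProjection (T (e i))‖ ^ 2

theorem norm_sub_starProjection_le (V : Submodule ℂ H) [FiniteDimensional ℂ V] (x : H) :
    ‖x - V.starProjection x‖ ≤ ‖x‖ := by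
  rw [← Submodule.starProjection_orthogonal_val]
  exact Submodule.norm_starProjection_apply_le _ _

theorem summable_projDefect {ι : Type*} (e : HilbertBasis ι ℂ H) {T : H →L[ℂ] H}
    (hT : Summable fun i => ‖T (e i)‖ ^ 2) (V : Submodule ℂ H) [FiniteDimensional ℂ V] :
    Summable fun i => ‖T (e i) - V.starProjection (T (e i))‖ ^ 2 :=
  hT.of_nonneg_of_le (fun _ => by positivity) fun i =>
    pow_le_pow_left₀ (norm_nonneg _) (norm_sub_starProjection_le V _) 2

/-- The defect tends to `0` along an exhausting sequence, by dominated convergence. -/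
theorem tendsto_projDefect {ι : Type*} (e : HilbertBasis ι ℂ H) {T : H →L[ℂ] H}
    (hT : Summable fun i => ‖T (e i)‖ ^ 2) (V : ℕ → Submodule ℂ H)
    [∀ J, FiniteDimensional ℂ (V J)] (hV : Monotone V) (hd : Dense (⋃ J, (V J : Set H))) :
    Tendsto (fun J => projDefect e T (V J)) atTop (𝓝 0) := by
  have hd' : ⊤ ≤ (⨆ J, V J).topologicalClosure := by
    refine (Submodule.dense_iff_topologicalClosure_eq_top.1 ?_).ge
    rwa [Submodule.coe_iSup_of_directed _ hV.directed_le]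
  have h : Tendsto (fun J => projDefect e T (V J)) atTop (𝓝 (∑' _ : ι, (0 : ℝ))) := by
    refine tendsto_tsum_of_dominated_convergence hT (fun i => ?_)
      (Eventually.of_forall fun J i => ?_)
    · have h1 := Submodule.starProjection_tendsto_self V hV (T (e i)) hd'
      have h2 := ((tendsto_const_nhds (x := T (e i))).sub h1).norm.pow 2
      simpa using h2
    · rw [Real.norm_of_nonneg (by positivity)]
      exact pow_le_pow_left₀ (norm_nonneg _) (norm_sub_starProjection_le (V J) _) 2
  simpa using h

theorem norm_sq_add_le {E : Type*} [SeminormedAddCommGroup E] (x y : E) :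
    ‖x + y‖ ^ 2 ≤ 2 * ‖x‖ ^ 2 + 2 * ‖y‖ ^ 2 := by
  have := pow_le_pow_left₀ (norm_nonneg _) (norm_add_le x y) 2
  nlinarith [sq_nonneg (‖x‖ - ‖y‖)]

/-- The compression of `T` to `V` and the operator `P_V T P_V` on a larger space `U` have the same
regularized determinant. -/
theorem finiteDet2_compression_eq (T : H →L[ℂ] H) {V U : Submodule ℂ H} [FiniteDimensional ℂ V]
    [FiniteDimensional ℂ U] (hVU : V ≤ U) :
    ∃ S : U →ₗ[ℂ] U, (∀ x : U, (S x : H) = V.starProjection (T (V.starProjection (x : H)))) ∧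
      finiteDet2 (compression T V : V →ₗ[ℂ] V) = finiteDet2 S := by
  let A : V →ₗ[ℂ] U := Submodule.inclusion hVU
  let B : U →ₗ[ℂ] V :=
    (V.orthogonalProjectionOnto ∘L T ∘L V.starProjection ∘L U.subtypeL : U →L[ℂ] V)
  refine ⟨A ∘ₗ B, fun x => rfl, ?_⟩
  rw [finiteDet2_comp_comm]
  congr 1
  ext x
  simp only [A, B, compression, LinearMap.comp_apply, ContinuousLinearMap.coe_coe,
    ContinuousLinearMap.comp_apply, Submodule.subtypeL_apply, Submodule.coe_inclusion,
    Submodule.starProjection_eq_self_iff.2 x.2]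

variable [CompleteSpace H]

/-- Split `T - P T P = (T - P T) + P (T - T P)`; the adjoint of `T - T P` is `T† - P T†`, so that
its Hilbert--Schmidt norm is the defect of `T†`. -/
theorem sum_norm_sq_sub_le {ι m : Type*} [Fintype m] (e : HilbertBasis ι ℂ H)
    {f : m → H} (hf : Orthonormal ℂ f) {T : H →L[ℂ] H}
    (hT : Summable fun i => ‖T (e i)‖ ^ 2) (V : Submodule ℂ H) [FiniteDimensional ℂ V] :
    ∑ k, ‖T (f k) - V.starProjection (T (V.starProjection (f k)))‖ ^ 2
      ≤ 2 * projDefect e T V + 2 * projDefect e T.adjoint V := by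
  have hT' := (hasSum_norm_sq_adjoint e hT).summable
  have h1 : ∑ k, ‖T (f k) - V.starProjection (T (f k))‖ ^ 2 ≤ projDefect e T V :=
    sum_norm_sq_le_tsum e hf (T := T - V.starProjection ∘L T) (summable_projDefect e hT V)
  have h2 : ∑ k, ‖T (f k) - T (V.starProjection (f k))‖ ^ 2 ≤ projDefect e T.adjoint V := by
    have hadj : (T - T ∘L V.starProjection).adjoint
        = T.adjoint - V.starProjection ∘L T.adjoint := by
      rw [map_sub, ContinuousLinearMap.adjoint_comp,
        (isSelfAdjoint_starProjection V).adjoint_eq]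
    have h3 := sum_norm_sq_le_tsum_adjoint e hf (T := T - T ∘L V.starProjection)
    rw [hadj] at h3
    exact h3 (summable_projDefect e hT' V)
  calc _ ≤ ∑ k, (2 * ‖T (f k) - V.starProjection (T (f k))‖ ^ 2
        + 2 * ‖T (f k) - T (V.starProjection (f k))‖ ^ 2) := by
        refine Finset.sum_le_sum fun k _ => ?_
        have h4 : T (f k) - V.starProjection (T (V.starProjection (f k)))
            = (T (f k) - V.starProjection (T (f k)))
              + V.starProjection (T (f k) - T (V.starProjection (f k))) := by
          rw [map_sub]; abel
        rw [h4]
        refine (norm_sq_add_le _ _).trans ?_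
        gcongr
        exact Submodule.norm_starProjection_apply_le _ _
    _ ≤ _ := by
      rw [Finset.sum_add_distrib, ← Finset.mul_sum, ← Finset.mul_sum]
      gcongr

/-- Two Galerkin approximations of a Hilbert--Schmidt operator that are close to it have nearby
regularized determinants: compare both on the sum of the two subspaces. -/
theorem norm_finiteDet2_compression_sub_le {ι : Type*} (e : HilbertBasis ι ℂ H) {T : H →L[ℂ] H}
    (hT : Summable fun i => ‖T (e i)‖ ^ 2) (V W : Submodule ℂ H) [FiniteDimensional ℂ V]
    [FiniteDimensional ℂ W] {r : ℝ} (hr : 0 < r) (hr1 : r < 1)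
    (hV : projDefect e T V + projDefect e T.adjoint V ≤ r ^ 2 / 8)
    (hW : projDefect e T W + projDefect e T.adjoint W ≤ r ^ 2 / 8) :
    ‖finiteDet2 (compression T V : V →ₗ[ℂ] V) - finiteDet2 (compression T W : W →ₗ[ℂ] W)‖
      ≤ 2 * Real.exp (2 * (∑' i, ‖T (e i)‖ ^ 2) + 2) * r := by
  obtain ⟨S, hS, hSV⟩ := finiteDet2_compression_eq T (le_sup_left : V ≤ V ⊔ W)
  obtain ⟨S', hS', hSW⟩ := finiteDet2_compression_eq T (le_sup_right : W ≤ V ⊔ W)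
  rw [hSV, hSW]
  let b := stdOrthonormalBasis ℂ ↥(V ⊔ W)
  have hf : Orthonormal ℂ fun k => ((b k : ↥(V ⊔ W)) : H) :=
    b.orthonormal.comp_linearIsometry (V ⊔ W).subtypeₗᵢ
  have h0 := sum_norm_sq_le_tsum e hf hT
  have hv := sum_norm_sq_sub_le e hf hT V
  have hw := sum_norm_sq_sub_le e hf hT W
  have hr2 : r ^ 2 < 1 := by nlinarith
  have hM : ∑ i, ‖S' (b i)‖ ^ 2 ≤ 2 * (∑' i, ‖T (e i)‖ ^ 2) + 1 := by
    have : ∑ i, ‖S' (b i)‖ ^ 2 ≤ ∑ k, (2 * ‖T (b k)‖ ^ 2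
        + 2 * ‖T (b k) - W.starProjection (T (W.starProjection (b k : H)))‖ ^ 2) := by
      refine Finset.sum_le_sum fun k _ => ?_
      rw [← Submodule.norm_coe, hS']
      have h5 := norm_sq_add_le (T (b k))
        (-(T (b k) - W.starProjection (T (W.starProjection (b k : H)))))
      rwa [norm_neg, neg_sub, add_sub_cancel] at h5
    rw [Finset.sum_add_distrib, ← Finset.mul_sum, ← Finset.mul_sum] at this
    linarith
  have hD : ∑ i, ‖S (b i) - S' (b i)‖ ^ 2 ≤ r ^ 2 := by
    have : ∑ i, ‖S (b i) - S' (b i)‖ ^ 2 ≤ ∑ k,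
        (2 * ‖T (b k) - W.starProjection (T (W.starProjection (b k : H)))‖ ^ 2
        + 2 * ‖T (b k) - V.starProjection (T (V.starProjection (b k : H)))‖ ^ 2) := by
      refine Finset.sum_le_sum fun k _ => ?_
      rw [← Submodule.norm_coe, Submodule.coe_sub, hS', hS]
      have h5 := norm_sq_add_le
        (T (b k) - W.starProjection (T (W.starProjection (b k : H))))
        (-(T (b k) - V.starProjection (T (V.starProjection (b k : H)))))
      rwa [norm_neg, neg_sub, add_comm, sub_add_sub_cancel] at h5
    rw [Finset.sum_add_distrib, ← Finset.mul_sum, ← Finset.mul_sum] at this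
    linarith
  refine (norm_finiteDet2_sub_le b hr hr1 hM hD).trans_eq ?_
  ring_nf

/-- Every Hilbert--Schmidt operator has a regularized determinant `det₂ (I - T)`. -/
theorem IsHilbertSchmidt.exists_hasDet2 {T : H →L[ℂ] H} (hT : IsHilbertSchmidt T) :
    ∃ d, HasDet2 T d := by
  obtain ⟨ι, e, he⟩ := id hT
  have he' := (hasSum_norm_sq_adjoint e he).summable
  set C : ℝ := 2 * Real.exp (2 * (∑' i, ‖T (e i)‖ ^ 2) + 2) with hC
  have hC0 : 0 < C := by positivity
  -- the radius at which a defect `r ^ 2 / 8` makes the determinants `ε`-close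
  have hrad (ε : ℝ) (hε : 0 < ε) : ∃ r, 0 < r ∧ r < 1 ∧ C * r < ε := by
    refine ⟨min (1 / 2) (ε / (2 * C)), by positivity, by
      linarith [min_le_left (1 / 2) (ε / (2 * C))], ?_⟩
    calc C * min (1 / 2) (ε / (2 * C)) ≤ C * (ε / (2 * C)) := by
          gcongr; exact min_le_right _ _
      _ = ε / 2 := by field_simp
      _ < ε := by linarith
  have hev (V : ℕ → Submodule ℂ H) [∀ J, FiniteDimensional ℂ (V J)] (hV : Monotone V)
      (hd : Dense (⋃ J, (V J : Set H))) (r : ℝ) (hr : 0 < r) : ∀ᶠ J in atTop,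
      projDefect e T (V J) + projDefect e T.adjoint (V J) ≤ r ^ 2 / 8 := by
    have h := (tendsto_projDefect e he V hV hd).add (tendsto_projDefect e he' V hV hd)
    rw [add_zero] at h
    exact h.eventually_le_const (by positivity)
  by_cases hex : ∃ V : ℕ → Submodule ℂ H, (∀ J, FiniteDimensional ℂ (V J)) ∧ Monotone V ∧
      Dense (⋃ J, (V J : Set H))
  · obtain ⟨V, hfin, hV, hd⟩ := hex
    have hcauchy : CauchySeq fun J => finiteDet2 (compression T (V J) : V J →ₗ[ℂ] V J) := by
      refine Metric.cauchySeq_iff'.2 fun ε hε => ?_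
      obtain ⟨r, hr, hr1, hrε⟩ := hrad ε hε
      obtain ⟨N, hN⟩ := eventually_atTop.1 (hev V hV hd r hr)
      refine ⟨N, fun J hJ => ?_⟩
      rw [dist_eq_norm]
      exact (norm_finiteDet2_compression_sub_le e he _ _ hr hr1 (hN J hJ) (hN N le_rfl)).trans_lt
        hrε
    obtain ⟨d, hlim⟩ := cauchySeq_tendsto_of_complete hcauchy
    refine ⟨d, hT, fun W _ hW hWd => ?_⟩
    have hdiff : Tendsto (fun J => finiteDet2 (compression T (W J) : W J →ₗ[ℂ] W J)
        - finiteDet2 (compression T (V J) : V J →ₗ[ℂ] V J)) atTop (𝓝 0) := by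
      refine Metric.tendsto_nhds.2 fun ε hε => ?_
      obtain ⟨r, hr, hr1, hrε⟩ := hrad ε hε
      filter_upwards [hev V hV hd r hr, hev W hW hWd r hr] with J hVJ hWJ
      rw [dist_zero_right]
      exact (norm_finiteDet2_compression_sub_le e he _ _ hr hr1 hWJ hVJ).trans_lt hrε
    simpa using hdiff.add hlim
  · -- without any exhausting sequence the convergence requirement is empty
    exact ⟨0, hT, fun V _ hV hd => (hex ⟨V, inferInstance, hV, hd⟩).elim⟩

theorem IsHilbertSchmidt.hasDet2_det2 {T : H →L[ℂ] H} (hT : IsHilbertSchmidt T) :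
    HasDet2 T (det2 T) := by
  rw [det2, dif_pos hT.exists_hasDet2]
  exact hT.exists_hasDet2.choose_spec

end HilbertSchmidt

/-! ### Determinants from matrix entries -/

section Entries

universe u

variable {H : Type u} [NormedAddCommGroup H] [InnerProductSpace ℂ H]

/-- In an orthonormal basis of `V` the compression of `T` to `V` has the entries `⟪v p, T v q⟫`. -/
theorem finiteDet2_compression_span {m : Type*} [Fintype m] [DecidableEq m] {v : m → H}
    (hv : Orthonormal ℂ v) (T : H →L[ℂ] H)
    [FiniteDimensional ℂ (Submodule.span ℂ (Set.range v))] :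
    finiteDet2 (compression T (Submodule.span ℂ (Set.range v)) :
        Submodule.span ℂ (Set.range v) →ₗ[ℂ] Submodule.span ℂ (Set.range v))
      = matDet2 (Matrix.of fun p q => inner ℂ (v p) (T (v q))) := by
  let b := Module.Basis.span hv.linearIndependent
  have hb (p : m) : (b p : H) = v p := by rw [Module.Basis.span_apply]
  have hbo : Orthonormal ℂ b := by
    rw [← (Submodule.span ℂ (Set.range v)).subtypeₗᵢ.orthonormal_comp_iff]
    convert! hv using 1
    exact funext hb
  let o := b.toOrthonormalBasis hbo
  have ho (p : m) : (o p : H) = v p := by rw [Module.Basis.coe_toOrthonormalBasis, hb]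
  rw [finiteDet2_eq_matDet2 o.toBasis]
  congr 1
  ext p q
  rw [LinearMap.toMatrix_apply, OrthonormalBasis.coe_toBasis,
    OrthonormalBasis.coe_toBasis_repr_apply, o.repr_apply_apply, Matrix.of_apply,
    ContinuousLinearMap.coe_coe, compression, ContinuousLinearMap.comp_apply,
    Submodule.inner_orthogonalProjectionOnto_eq_of_mem_left, ho]
  simp [ho]

/-- The regularized determinant is the limit along the sections of a Hilbert basis. -/
theorem HasDet2.tendsto_matDet2 {ι : Type*} (e : HilbertBasis ι ℂ H) {T : H →L[ℂ] H} {d : ℂ}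
    (h : HasDet2 T d) {m : ℕ → Type*} [∀ J, Fintype (m J)] [∀ J, DecidableEq (m J)]
    (f : ∀ J, m J → ι) (hf : ∀ J, Function.Injective (f J))
    (hmono : Monotone fun J => Set.range (f J)) (hex : ∀ i, ∃ J, i ∈ Set.range (f J)) :
    Tendsto (fun J => matDet2 (Matrix.of fun p q : m J =>
      inner ℂ (e (f J p)) (T (e (f J q))))) atTop (𝓝 d) := by
  let V : ℕ → Submodule ℂ H := fun J => Submodule.span ℂ (Set.range fun p => e (f J p))
  have hfin (J : ℕ) : FiniteDimensional ℂ (V J) :=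
    FiniteDimensional.span_of_finite ℂ (Set.finite_range _)
  have hr (J : ℕ) : (Set.range fun p => e (f J p)) = e '' Set.range (f J) :=
    Set.range_comp e (f J)
  have hV : Monotone V := fun J K hJK => by
    refine Submodule.span_mono ?_
    rw [hr, hr]
    exact Set.image_mono (hmono hJK)
  have hd : Dense (⋃ J, (V J : Set H)) := by
    rw [← Submodule.coe_iSup_of_directed _ hV.directed_le,
      Submodule.dense_iff_topologicalClosure_eq_top, eq_top_iff, ← e.dense_span]
    refine Submodule.topologicalClosure_mono (Submodule.span_le.2 ?_)
    rintro _ ⟨i, rfl⟩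
    obtain ⟨J, p, hp⟩ := hex i
    exact Submodule.mem_iSup_of_mem J (Submodule.subset_span ⟨p, by simp only [hp]⟩)
  refine (h.2 V hV hd).congr fun J => ?_
  have : FiniteDimensional ℂ (Submodule.span ℂ (Set.range (e ∘ f J))) := hfin J
  exact finiteDet2_compression_span (e.orthonormal.comp _ (hf J)) T

end Entries

/-! ### The Fourier basis of vector functions -/

section Vector

variable {ι : Type} [Fintype ι]

open Classical in
/-- The vector function `e^{ikx}` in the component `b`, zero in the others. -/
noncomputable def vecFourier (p : ℤ × ι) : VecL2 ι :=
  PiLp.single 2 p.2 (fourierLp (T := 2 * Real.pi) 2 p.1)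

theorem vecFourier_apply [DecidableEq ι] (k : ℤ) (b c : ι) :
    vecFourier (k, b) c = if c = b then fourierLp (T := 2 * Real.pi) 2 k else 0 := by
  by_cases h : c = b
  · subst h; simp [vecFourier]
  · simp [vecFourier, h]

/-- Pairing with the basis functions reads off the Fourier coefficients of the components. -/
theorem inner_vecFourier (j : ℤ) (a : ι) (U : VecL2 ι) :
    inner ℂ (vecFourier (j, a)) U = fourierCoeff (U a) j := by
  classical
  rw [PiLp.inner_apply, Finset.sum_eq_single a]
  · rw [vecFourier_apply, if_pos rfl, ← coe_fourierBasis, ← fourierBasis.repr_apply_apply,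
      fourierBasis_repr]
  · intro c _ hc
    rw [vecFourier_apply, if_neg hc, inner_zero_left]
  · simp

theorem orthonormal_vecFourier : Orthonormal ℂ (vecFourier (ι := ι)) := by
  classical
  rw [orthonormal_iff_ite]
  rintro ⟨j, a⟩ ⟨k, b⟩
  rw [inner_vecFourier, vecFourier_apply]
  by_cases h : a = b
  · rw [if_pos h, ← fourierBasis_repr, ← coe_fourierBasis, HilbertBasis.repr_self]
    by_cases hjk : j = k
    · simp [h, hjk]
    · simp [h, hjk, lp.single_apply]
  · rw [if_neg h, if_neg (by simp [h]), ← fourierBasis_repr]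
    simp

/-- The exponentials in the components form a Hilbert basis of the periodic vector functions. -/
noncomputable def vecBasis (ι : Type) [Fintype ι] : HilbertBasis (ℤ × ι) ℂ (VecL2 ι) :=
  HilbertBasis.mkOfOrthogonalEqBot (orthonormal_vecFourier (ι := ι)) <| by
    rw [Submodule.eq_bot_iff]
    intro U hU
    rw [Submodule.mem_orthogonal] at hU
    ext1 a
    refine fourierBasis.repr.injective ?_
    ext j
    rw [fourierBasis_repr, ← inner_vecFourier, hU _ (Submodule.subset_span ⟨(j, a), rfl⟩)]
    simp

theorem coe_vecBasis : ⇑(vecBasis ι) = vecFourier :=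
  HilbertBasis.coe_mkOfOrthogonalEqBot _ _

theorem fourierCoeff_mul_fourier (m : L2) (j k : ℤ) :
    fourierCoeff (fun x => m x * (fourierLp (T := 2 * Real.pi) 2 k : L2) x) j
      = fourierCoeff m (j - k) := by
  refine integral_congr_ae ?_
  filter_upwards [coeFn_fourierLp (T := 2 * Real.pi) 2 k] with x hx
  rw [hx, smul_eq_mul, smul_eq_mul, neg_sub, sub_eq_add_neg, add_comm k, fourier_add]
  ring

/-- The Fourier matrix of `s(D) M` has the entries `s j * M̂_{ab}(j - k)`. -/
theorem inner_vecOp (s : lp (fun _ : ℤ => ℂ) 2) (M : Matrix ι ι L2) (p q : ℤ × ι) :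
    inner ℂ (vecBasis ι p) (vecOp s M (vecBasis ι q))
      = s p.1 * fourierCoeff (M p.2 q.2) (p.1 - q.1) := by
  classical
  obtain ⟨j, a⟩ := p
  obtain ⟨k, b⟩ := q
  rw [coe_vecBasis, inner_vecFourier, vecOp_apply, Finset.sum_eq_single b]
  · rw [fourierCoeff_scalarOp, vecFourier_apply, if_pos rfl, fourierCoeff_mul_fourier]
  · intro c _ hc
    rw [vecFourier_apply, if_neg hc, map_zero]
  · simp

/-- The squared entries `|s j|² |M̂_{ab}(j - k)|²` become a product of two summable families after
the substitution `(j, k) ↦ (j, j - k)`. -/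
theorem summable_norm_sq_vecOp (s : lp (fun _ : ℤ => ℂ) 2) (M : Matrix ι ι L2) :
    Summable fun q => ‖vecOp s M (vecBasis ι q)‖ ^ 2 := by
  have hs : Summable fun j : ℤ => ‖s j‖ ^ 2 := by
    simpa using (lp.memℓp s).summable (by norm_num)
  have hM (f : L2) : Summable fun j : ℤ => ‖fourierCoeff f j‖ ^ 2 :=
    (hasSum_sq_fourierCoeff f).summable
  have hfull : Summable fun r : (ℤ × ι) × (ℤ × ι) =>
      ‖inner ℂ (vecBasis ι r.2) (vecOp s M (vecBasis ι r.1))‖ ^ 2 := by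
    have h1 (x : ι × ι) : Summable fun y : ℤ × ℤ =>
        ‖s y.1‖ ^ 2 * ‖fourierCoeff (M x.1 x.2) (y.1 - y.2)‖ ^ 2 := by
      have h2 := hs.mul_of_nonneg (hM (M x.1 x.2)) (fun _ => by positivity)
        (fun _ => by positivity)
      let E : ℤ × ℤ ≃ ℤ × ℤ :=
        ⟨fun y => (y.1, y.1 - y.2), fun y => (y.1, y.1 - y.2), fun y => by simp, fun y => by simp⟩
      exact (E.summable_iff (f := fun y : ℤ × ℤ =>
        ‖s y.1‖ ^ 2 * ‖fourierCoeff (M x.1 x.2) y.2‖ ^ 2)).2 h2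
    have h3 : Summable fun z : (ι × ι) × (ℤ × ℤ) =>
        ‖s z.2.1‖ ^ 2 * ‖fourierCoeff (M z.1.1 z.1.2) (z.2.1 - z.2.2)‖ ^ 2 := by
      rw [summable_prod_of_nonneg fun z => by positivity]
      exact ⟨h1, Summable.of_finite⟩
    let E : (ℤ × ι) × (ℤ × ι) ≃ (ι × ι) × (ℤ × ℤ) :=
      ⟨fun r => ((r.2.2, r.1.2), (r.2.1, r.1.1)), fun z => ((z.2.2, z.1.2), (z.2.1, z.1.1)),
        fun _ => rfl, fun _ => rfl⟩
    refine ((E.summable_iff).2 h3).congr fun r => ?_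
    rw [inner_vecOp, norm_mul, mul_pow]
    rfl
  have h := hfull.prod
  simpa only [((vecBasis ι).hasSum_norm_sq_inner _).tsum_eq] using h

theorem isHilbertSchmidt_vecOp (s : lp (fun _ : ℤ => ℂ) 2) (M : Matrix ι ι L2) :
    IsHilbertSchmidt (vecOp s M) :=
  ⟨_, vecBasis ι, summable_norm_sq_vecOp s M⟩

/-- The determinant of an operator on vector functions is the limit of those of its Fourier
truncations. -/
theorem HasDet2.tendsto_fourier [DecidableEq ι] {T : VecL2 ι →L[ℂ] VecL2 ι} {d : ℂ}
    (h : HasDet2 T d) :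
    Tendsto (fun J : ℕ => matDet2 (Matrix.of fun p q : Finset.Icc (-(J : ℤ)) J × ι =>
      inner ℂ (vecBasis ι ((p.1 : ℤ), p.2)) (T (vecBasis ι ((q.1 : ℤ), q.2))))) atTop (𝓝 d) := by
  have hr (J : ℕ) (x : ℤ × ι) : x ∈ Set.range (fun p : Finset.Icc (-(J : ℤ)) J × ι =>
      ((p.1 : ℤ), p.2)) ↔ x.1 ∈ Finset.Icc (-(J : ℤ)) J :=
    ⟨by rintro ⟨p, rfl⟩; exact p.1.2, fun hx => ⟨(⟨x.1, hx⟩, x.2), rfl⟩⟩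
  refine h.tendsto_matDet2 (vecBasis ι) (m := fun J => Finset.Icc (-(J : ℤ)) J × ι)
    (fun J p => ((p.1 : ℤ), p.2)) ?_ ?_ ?_
  · rintro J ⟨p, a⟩ ⟨q, b⟩ hpq
    simp only [Prod.mk.injEq] at hpq
    exact Prod.ext (Subtype.ext hpq.1) hpq.2
  · intro J K hJK x
    simp only [hr, Finset.mem_Icc]
    omega
  · intro x
    refine ⟨x.1.natAbs, ?_⟩
    rw [hr, Finset.mem_Icc]
    omega

end Vector

/-! ### The constants -/

section Constants

theorem I_mul_int_sub_one_ne_zero (j : ℤ) : Complex.I * (j : ℂ) - 1 ≠ 0 := fun h => by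
  simpa using congrArg Complex.re h

theorem I_mul_int_add_one_ne_zero (j : ℤ) : Complex.I * (j : ℂ) + 1 ≠ 0 := fun h => by
  simpa using congrArg Complex.re h

theorem I_mul_int_sq_sub_one (j : ℤ) : (Complex.I * (j : ℂ)) ^ 2 - 1 = -((j : ℂ) ^ 2 + 1) := by
  rw [mul_pow, Complex.I_sq]; ring

theorem int_sq_add_one_ne_zero (j : ℤ) : (j : ℂ) ^ 2 + 1 ≠ 0 := by
  exact_mod_cast (by positivity : (j : ℝ) ^ 2 + 1 ≠ 0)

theorem sum_Icc_neg (f : ℤ → ℂ) (J : ℕ) :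
    ∑ j ∈ Finset.Icc (-(J : ℤ)) J, f (-j) = ∑ j ∈ Finset.Icc (-(J : ℤ)) J, f j :=
  Finset.sum_equiv (Equiv.neg ℤ) (fun j => by simp only [Finset.mem_Icc, Equiv.neg_apply]; omega)
    fun _ _ => rfl

theorem prod_Icc_neg (f : ℤ → ℂ) (J : ℕ) :
    ∏ j ∈ Finset.Icc (-(J : ℤ)) J, f (-j) = ∏ j ∈ Finset.Icc (-(J : ℤ)) J, f j :=
  Finset.prod_equiv (Equiv.neg ℤ) (fun j => by simp only [Finset.mem_Icc, Equiv.neg_apply]; omega)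
    fun _ _ => rfl

/-- Reflecting `j` changes each of the `2 J + 1` factors by a sign. -/
theorem prod_Icc_inv_add_one (J : ℕ) :
    ∏ j ∈ Finset.Icc (-(J : ℤ)) J, (Complex.I * (j : ℂ) + 1)⁻¹
      = -∏ j ∈ Finset.Icc (-(J : ℤ)) J, (Complex.I * (j : ℂ) - 1)⁻¹ := by
  rw [← prod_Icc_neg]
  have h (j : ℤ) : (Complex.I * ((-j : ℤ) : ℂ) + 1)⁻¹ = -1 * (Complex.I * (j : ℂ) - 1)⁻¹ := by
    rw [neg_one_mul, ← inv_neg]; push_cast; ring_nf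
  have hc : (Finset.Icc (-(J : ℤ)) J).card = 2 * J + 1 := by rw [Int.card_Icc]; omega
  rw [Finset.prod_congr rfl fun j _ => h j, Finset.prod_mul_distrib, Finset.prod_const, hc,
    pow_succ, pow_mul]
  simp

/-- The partial products defining `ε` do not depend on `J`: the factors of `j` and `-j` cancel, and
`j = 0` contributes `(-1)ⁿ`. -/
theorem epsilonTrunc_eq (n J : ℕ) : epsilonTrunc n J = (-1) ^ n := by
  rw [epsilonTrunc, Finset.prod_pow]
  congr 1
  have h (j : ℤ) : 1 - 2 / (Complex.I * (j : ℂ) + 1)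
      = (Complex.I * (j : ℂ) - 1) * (Complex.I * (j : ℂ) + 1)⁻¹ := by
    have := I_mul_int_add_one_ne_zero j
    field_simp
    ring
  rw [Finset.prod_congr rfl fun j _ => h j, Finset.prod_mul_distrib, prod_Icc_inv_add_one,
    mul_neg, ← Finset.prod_mul_distrib]
  simp [I_mul_int_sub_one_ne_zero]

theorem tendsto_epsilonTrunc (n : ℕ) : Tendsto (epsilonTrunc n) atTop (𝓝 (epsilon n)) := by
  have h : Tendsto (epsilonTrunc n) atTop (𝓝 ((-1) ^ n)) :=
    tendsto_const_nhds.congr fun J => (epsilonTrunc_eq n J).symm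
  exact tendsto_nhds_limUnder ⟨_, h⟩

theorem summable_inv_sq_add_one : Summable fun j : ℤ => 1 / ((j : ℂ) ^ 2 + 1) := by
  refine (Complex.ofRealCLM.summable summable_symbol).congr fun j => ?_
  simp

theorem summable_inv_sq_add_I_mul :
    Summable fun j : ℤ => 1 / ((j : ℂ) ^ 2 + Complex.I * j) := by
  refine Summable.of_norm_bounded (Real.summable_one_div_int_pow.2 (by norm_num : 1 < 2))
    fun j => ?_
  by_cases hj : j = 0
  · simp [hj]
  have h0 : (0 : ℝ) < (j : ℝ) ^ 2 := by positivity
  rw [norm_div, norm_one]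
  refine one_div_le_one_div_of_le h0 ?_
  refine le_trans (le_of_eq ?_) (Complex.abs_re_le_norm _)
  rw [show (((j : ℂ) ^ 2 + Complex.I * j).re) = (j : ℝ) ^ 2 by simp [sq], abs_of_pos h0]

/-- The odd parts of the summands cancel. -/
theorem one_add_tsum_inv_sq_add_I_mul :
    1 + ∑' j : {j : ℤ // j ≠ 0}, 1 / (((j : ℤ) : ℂ) ^ 2 + Complex.I * (j : ℤ))
      = ∑' j : ℤ, 1 / ((j : ℂ) ^ 2 + 1) := by
  set g : ℤ → ℂ := fun j => 1 / ((j : ℂ) ^ 2 + Complex.I * j) with hg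
  -- the division by zero makes `g 0 = 0`
  have hsub : ∑' j : {j : ℤ // j ≠ 0}, g j = ∑' j : ℤ, g j :=
    tsum_subtype_eq_of_support_subset (s := {j : ℤ | j ≠ 0}) fun j hj h0 => hj (by simp [hg, h0])
  have hg' : HasSum g (∑' j : ℤ, g j) := summable_inv_sq_add_I_mul.hasSum
  have hf : HasSum (fun j : ℤ => (if j = 0 then (1 : ℂ) else 0) + g j) (1 + ∑' j : ℤ, g j) :=
    (hasSum_ite_eq (0 : ℤ) (1 : ℂ)).add hg'
  have h2 := hf.add ((Equiv.neg ℤ).hasSum_iff.2 hf)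
  have h3 := summable_inv_sq_add_one.hasSum.mul_left 2
  -- the terms of `j` and `-j` add up to `2 / (j² + 1)`
  have h4 := h2.unique (h3.congr_fun fun j => ?_)
  · change 1 + ∑' j : {j : ℤ // j ≠ 0}, g j = _
    rw [hsub]
    linear_combination h4 / 2
  · by_cases hj : j = 0
    · simp [hg, hj]; norm_num
    · have hj' : (j : ℂ) ≠ 0 := by exact_mod_cast hj
      have h5 : (j : ℂ) + Complex.I ≠ 0 := fun h => by
        simpa using congrArg Complex.im h
      have h6 : (j : ℂ) - Complex.I ≠ 0 := fun h => by
        simpa using congrArg Complex.im h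
      have h7 := int_sq_add_one_ne_zero j
      have e1 : (j : ℂ) ^ 2 + Complex.I * j = j * (j + Complex.I) := by ring
      have e2 : ((-j : ℤ) : ℂ) ^ 2 + Complex.I * ((-j : ℤ) : ℂ) = j * (j - Complex.I) := by
        push_cast; ring
      have e3 : (j : ℂ) ^ 2 + 1 = (j + Complex.I) * (j - Complex.I) := by
        ring_nf; rw [Complex.I_sq]; ring
      simp only [hg, Function.comp_apply, Equiv.neg_apply, neg_eq_zero, hj, if_false, zero_add]
      rw [e1, e2, e3]
      field_simp
      ring

theorem tendsto_sum_Icc {f : ℤ → ℂ} (hf : Summable f) :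
    Tendsto (fun J : ℕ => ∑ j ∈ Finset.Icc (-(J : ℤ)) J, f j) atTop (𝓝 (∑' j, f j)) := by
  refine hf.hasSum.comp (tendsto_atTop_finset_of_monotone ?_ fun j => ⟨j.natAbs, ?_⟩)
  · intro J K hJK
    exact Finset.Icc_subset_Icc (by simpa using hJK) (by simpa using hJK)
  · rw [Finset.mem_Icc]; omega

theorem sum_Icc_inv_sub_one (J : ℕ) :
    ∑ j ∈ Finset.Icc (-(J : ℤ)) J, 1 / (Complex.I * (j : ℂ) - 1)
      = -∑ j ∈ Finset.Icc (-(J : ℤ)) J, 1 / ((j : ℂ) ^ 2 + 1) := by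
  have h := sum_Icc_neg (fun j => 1 / (Complex.I * (j : ℂ) - 1)) J
  have h2 : ∑ j ∈ Finset.Icc (-(J : ℤ)) J, (1 / (Complex.I * ((-j : ℤ) : ℂ) - 1)
      + 1 / (Complex.I * (j : ℂ) - 1))
      = ∑ j ∈ Finset.Icc (-(J : ℤ)) J, (-2) * (1 / ((j : ℂ) ^ 2 + 1)) := by
    refine Finset.sum_congr rfl fun j _ => ?_
    have h1 := I_mul_int_sub_one_ne_zero j
    have h2 := I_mul_int_add_one_ne_zero j
    have e1 : Complex.I * ((-j : ℤ) : ℂ) - 1 = -(Complex.I * j + 1) := by push_cast; ring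
    have e2 : (j : ℂ) ^ 2 + 1 = -((Complex.I * j + 1) * (Complex.I * j - 1)) := by
      linear_combination I_mul_int_sq_sub_one j
    rw [e1, e2]
    field_simp
    ring
  rw [Finset.sum_add_distrib, ← Finset.mul_sum, h] at h2
  linear_combination h2 / 2

theorem sum_Icc_symbolDR (J : ℕ) : ∑ j ∈ Finset.Icc (-(J : ℤ)) J, symbolDR j = 0 := by
  have h := sum_Icc_neg (fun j => symbolDR j) J
  have h2 (j : ℤ) : symbolDR (-j) = -symbolDR j := by
    change (Complex.I * ((-j : ℤ) : ℂ)) / ((Complex.I * ((-j : ℤ) : ℂ)) ^ 2 - 1)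
      = -((Complex.I * (j : ℂ)) / ((Complex.I * (j : ℂ)) ^ 2 - 1))
    push_cast
    ring
  simp only [h2, Finset.sum_neg_distrib] at h
  linear_combination -h / 2

theorem symbolR_apply (j : ℤ) : symbolR j = -(1 / ((j : ℂ) ^ 2 + 1)) := by
  change 1 / ((Complex.I * (j : ℂ)) ^ 2 - 1) = _
  rw [I_mul_int_sq_sub_one, div_neg]

end Constants

/-! ### Reduction of the first-order determinant -/

section Algebra

variable {P : Type*} [Fintype P] [DecidableEq P] {R : Type*} [CommRing R]

/-- The companion matrix of a second-order pencil has the determinant of the pencil. -/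
theorem det_companion (D C E : Matrix P P R) :
    (Matrix.fromBlocks D (-1) C E).det = (C + E * D).det := by
  -- clear the upper left block to `1`, then take the Schur complement
  have h : Matrix.fromBlocks D (-1) C E * Matrix.fromBlocks 1 0 (D - 1) 1
      = Matrix.fromBlocks 1 (-1) (C + E * (D - 1)) E := by
    rw [Matrix.fromBlocks_multiply]
    congr 1 <;> simp
  have h2 := congrArg Matrix.det h
  rw [Matrix.det_mul, Matrix.det_fromBlocks_zero₁₂, Matrix.det_one, mul_one, mul_one,
    Matrix.det_fromBlocks_one₁₁] at h2
  rw [h2]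
  congr 1
  noncomm_ring

theorem det_one_sub_firstOrder {S D A C : Matrix P P R} (hS : S * (D - 1) = 1) :
    (1 - Matrix.fromBlocks S 0 0 S *
      Matrix.fromBlocks (-1) 1 (-C - (D * A - A * D)) (-A - 1)).det
      = S.det ^ 2 * (D * D + D * A + C).det := by
  have h : 1 - Matrix.fromBlocks S 0 0 S *
      Matrix.fromBlocks (-1) 1 (-C - (D * A - A * D)) (-A - 1)
      = Matrix.fromBlocks S 0 0 S * Matrix.fromBlocks D (-1) (C + (D * A - A * D)) (A + D) := by
    have h1 : (1 : Matrix (P ⊕ P) (P ⊕ P) R) = Matrix.fromBlocks S 0 0 S *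
        Matrix.fromBlocks (D - 1) 0 0 (D - 1) := by
      simp [Matrix.fromBlocks_multiply, hS]
    conv_lhs => rw [h1]
    rw [← mul_sub]
    congr 1
    rw [sub_eq_add_neg, Matrix.fromBlocks_neg, Matrix.fromBlocks_add]
    congr 1 <;> abel
  rw [h, Matrix.det_mul, Matrix.det_fromBlocks_zero₁₂, det_companion, sq]
  congr 2
  noncomm_ring

theorem det_one_sub_secondOrder {Q D A C : Matrix P P R} (hQ : Q * (D * D - 1) = 1) :
    (1 - (-(Q * D * A) - Q * (C + 1))).det = Q.det * (D * D + D * A + C).det := by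
  rw [← Matrix.det_mul, show (1 : Matrix P P R) - (-(Q * D * A) - Q * (C + 1))
    = Q * (D * D - 1) - (-(Q * D * A) - Q * (C + 1)) by rw [hQ]]
  congr 1
  noncomm_ring

end Algebra

/-! ### Fourier truncations of the two Evans functions -/

section Truncation

variable {n : ℕ}

theorem fourierCoeff_oneL2 (m : ℤ) : fourierCoeff oneL2 m = if m = 0 then 1 else 0 := by
  have h : fourierCoeff oneL2 = fourierCoeff (T := 2 * Real.pi) (fourier 0) := by
    refine fourierCoeff_congr_ae ?_
    filter_upwards [Lp.coeFn_const (p := 2) (μ := (AddCircle.haarAddCircle : Measure Circ))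
      (c := (1 : ℂ))] with x hx
    rw [oneL2, hx, Function.const_apply, fourier_zero]
  rw [h, fourierCoeff_fourier, Pi.single_apply]

theorem fourierCoeff_add_L2 (f g : L2) (m : ℤ) :
    fourierCoeff (f + g : L2) m = fourierCoeff f m + fourierCoeff g m := by
  simp only [← fourierBasis_repr, map_add, lp.coeFn_add, Pi.add_apply]

theorem fourierCoeff_neg_L2 (f : L2) (m : ℤ) :
    fourierCoeff (-f : L2) m = -fourierCoeff f m := by
  simp only [← fourierBasis_repr, map_neg, lp.coeFn_neg, Pi.neg_apply]

theorem fourierCoeff_sub_L2 (f g : L2) (m : ℤ) :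
    fourierCoeff (f - g : L2) m = fourierCoeff f m - fourierCoeff g m := by
  simp only [← fourierBasis_repr, map_sub, lp.coeFn_sub, Pi.sub_apply]

theorem fourierCoeff_smul_L2 (c : ℂ) (f : L2) (m : ℤ) :
    fourierCoeff (c • f : L2) m = c * fourierCoeff f m := by
  simp only [← fourierBasis_repr, map_smul, lp.coeFn_smul, Pi.smul_apply, smul_eq_mul]

theorem fourierCoeff_zero_L2 (m : ℤ) : fourierCoeff (0 : L2) m = 0 := by
  simp only [← fourierBasis_repr, map_zero, lp.coeFn_zero, Pi.zero_apply]

theorem fourierCoeff_oneMat (a b : Fin n) (m : ℤ) :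
    fourierCoeff (oneMat n a b) m = if a = b ∧ m = 0 then 1 else 0 := by
  by_cases h : a = b
  · subst h; simp [oneMat, fourierCoeff_oneL2]
  · rw [oneMat, Matrix.diagonal_apply_ne _ h, fourierCoeff_zero_L2, if_neg fun h' => h h'.1]

/-- The wave numbers `|j| ≤ J` of a truncation. -/
abbrev Modes (J : ℕ) : Type := Finset.Icc (-(J : ℤ)) J

/-- The block Toeplitz matrix of multiplication by a matrix function, truncated to `|j| ≤ J`. -/
noncomputable def toeplitz (A : Matrix (Fin n) (Fin n) L2) (J : ℕ) :
    Matrix (Modes J × Fin n) (Modes J × Fin n) ℂ :=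
  Matrix.of fun p q => fourierCoeff (A p.2 q.2) ((p.1 : ℤ) - q.1)

/-- The truncation to `|j| ≤ J` of the Fourier multiplier with symbol `s`. -/
noncomputable def symbolDiag (n : ℕ) (s : ℤ → ℂ) (J : ℕ) :
    Matrix (Modes J × Fin n) (Modes J × Fin n) ℂ :=
  Matrix.diagonal fun p => s p.1

theorem det_symbolDiag (s : ℤ → ℂ) (J : ℕ) :
    (symbolDiag n s J).det = (∏ j ∈ Finset.Icc (-(J : ℤ)) J, s j) ^ n := by
  rw [symbolDiag, Matrix.det_diagonal, Fintype.prod_prod_type, ← Finset.prod_pow,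
    ← Finset.prod_coe_sort (Finset.Icc (-(J : ℤ)) J) fun j => s j ^ n]
  simp

theorem symbolDiag_mul (s t : ℤ → ℂ) (J : ℕ) :
    symbolDiag n s J * symbolDiag n t J = symbolDiag n (fun j => s j * t j) J := by
  simp [symbolDiag]

theorem symbolDiag_one (J : ℕ) : symbolDiag n (fun _ => 1) J = 1 := by
  simp [symbolDiag]

theorem symbolDiag_sub (s t : ℤ → ℂ) (J : ℕ) :
    symbolDiag n s J - symbolDiag n t J = symbolDiag n (fun j => s j - t j) J := by
  simp [symbolDiag]

/-- The truncation to `|j| ≤ J` of the Fourier matrix of `K(λ)`. -/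
noncomputable def secondOrderTrunc (A₁ A₀ B₀ : Matrix (Fin n) (Fin n) L2) (lam : ℂ) (J : ℕ) :
    Matrix (Modes J × Fin n) (Modes J × Fin n) ℂ :=
  Matrix.of fun p q => inner ℂ (vecBasis (Fin n) ((p.1 : ℤ), p.2))
    (birmanSchwinger A₁ A₀ B₀ lam (vecBasis (Fin n) ((q.1 : ℤ), q.2)))

theorem secondOrderTrunc_apply (A₁ A₀ B₀ : Matrix (Fin n) (Fin n) L2) (lam : ℂ) (J : ℕ)
    (p q : Modes J × Fin n) :
    secondOrderTrunc A₁ A₀ B₀ lam J p q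
      = -(symbolDR p.1 * coeffMat A₁ (p.1 - q.1) p.2 q.2)
        - symbolR p.1 * (coeffMat A₀ (p.1 - q.1) p.2 q.2 + (if p = q then 1 else 0)
          - lam * coeffMat B₀ (p.1 - q.1) p.2 q.2) := by
  have hpq : (p.2 = q.2 ∧ (p.1 : ℤ) - q.1 = 0) ↔ p = q := by
    rw [Prod.ext_iff, Subtype.ext_iff, sub_eq_zero, and_comm]
  rw [secondOrderTrunc, Matrix.of_apply, birmanSchwinger, sub_apply,
    neg_apply, inner_sub_right, inner_neg_right, inner_vecOp, inner_vecOp]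
  simp only [Matrix.sub_apply, Matrix.add_apply, Matrix.smul_apply, fourierCoeff_sub_L2,
    fourierCoeff_add_L2, fourierCoeff_smul_L2, fourierCoeff_oneMat, coeffMat, Matrix.of_apply, hpq]

theorem secondOrderTrunc_eq (A₁ A₀ B₀ : Matrix (Fin n) (Fin n) L2) (lam : ℂ) (J : ℕ) :
    secondOrderTrunc A₁ A₀ B₀ lam J
      = -(symbolDiag n symbolR J * symbolDiag n (fun j => Complex.I * j) J * toeplitz A₁ J)
        - symbolDiag n symbolR J * (toeplitz A₀ J - lam • toeplitz B₀ J + 1) := by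
  ext p q
  have hs : symbolDR p.1 = symbolR p.1 * (Complex.I * (p.1 : ℤ)) := by
    change (Complex.I * ((p.1 : ℤ) : ℂ)) / ((Complex.I * ((p.1 : ℤ) : ℂ)) ^ 2 - 1)
      = 1 / ((Complex.I * ((p.1 : ℤ) : ℂ)) ^ 2 - 1) * (Complex.I * (p.1 : ℤ))
    ring
  rw [secondOrderTrunc_apply, symbolDiag_mul, hs]
  simp only [symbolDiag, toeplitz, coeffMat, Matrix.sub_apply, Matrix.neg_apply,
    Matrix.add_apply, Matrix.smul_apply, Matrix.diagonal_mul, Matrix.of_apply, Matrix.one_apply,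
    smul_eq_mul]
  ring

/-- The truncation of `𝕂(λ)` in block form. The derivative of `A₁` appears as the commutator
`D A₁ - A₁ D`, since `i (j - k) Â₁(j - k)` are its entries. -/
theorem firstOrderTrunc_reindex (A₁ A₀ B₀ : Matrix (Fin n) (Fin n) L2) (lam : ℂ) (J : ℕ) :
    Matrix.reindex (Equiv.prodSumDistrib _ _ _) (Equiv.prodSumDistrib _ _ _)
        (firstOrderTrunc A₁ A₀ B₀ lam J)
      = Matrix.fromBlocks (symbolDiag n symbolR1 J) 0 0 (symbolDiag n symbolR1 J) *
        Matrix.fromBlocks (-1) 1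
          (-(toeplitz A₀ J - lam • toeplitz B₀ J)
            - (symbolDiag n (fun j => Complex.I * j) J * toeplitz A₁ J
              - toeplitz A₁ J * symbolDiag n (fun j => Complex.I * j) J))
          (-toeplitz A₁ J - 1) := by
  have hs (j : ℤ) : symbolR1 j = 1 / (Complex.I * j - 1) := rfl
  rw [Matrix.fromBlocks_multiply]
  ext p q
  rcases p with ⟨⟨j, hj⟩, a⟩ | ⟨⟨j, hj⟩, a⟩ <;> rcases q with ⟨⟨k, hk⟩, b⟩ | ⟨⟨k, hk⟩, b⟩ <;>
    by_cases hjk : j = k <;> by_cases hab : a = b <;>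
    simp [-mul_eq_mul_left_iff, -mul_eq_mul_right_iff, firstOrderTrunc, systemCoeff, symbolDiag,
      toeplitz, coeffMat, hs, Matrix.diagonal_mul, Matrix.mul_diagonal, sub_eq_zero, hjk,
      hab] <;> ring

/-- Both truncated determinants reduce to that of the pencil `D² + D A₁ + A₀ - λ B₀`; the
preconditioners `(D - 1)²` and `D² - 1` differ by the factor `ε`. -/
theorem det_one_sub_firstOrderTrunc (A₁ A₀ B₀ : Matrix (Fin n) (Fin n) L2) (lam : ℂ) (J : ℕ) :
    (1 - firstOrderTrunc A₁ A₀ B₀ lam J).det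
      = (-1) ^ n * (1 - secondOrderTrunc A₁ A₀ B₀ lam J).det := by
  have hs (j : ℤ) : symbolR1 j = (Complex.I * j - 1)⁻¹ := one_div _
  have hr (j : ℤ) : symbolR j = ((Complex.I * j) ^ 2 - 1)⁻¹ := one_div _
  have hr' (j : ℤ) : symbolR j = symbolR1 j * (Complex.I * j + 1)⁻¹ := by
    rw [hs, hr, ← mul_inv]; ring_nf
  have hS : symbolDiag n symbolR1 J * (symbolDiag n (fun j => Complex.I * j) J - 1) = 1 := by
    rw [← symbolDiag_one, symbolDiag_sub, symbolDiag_mul]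
    congr 1
    funext j
    rw [hs, inv_mul_cancel₀ (I_mul_int_sub_one_ne_zero j)]
  have hQ : symbolDiag n symbolR J * (symbolDiag n (fun j => Complex.I * j) J
      * symbolDiag n (fun j => Complex.I * j) J - 1) = 1 := by
    rw [← symbolDiag_one, symbolDiag_mul, symbolDiag_sub, symbolDiag_mul]
    congr 1
    funext j
    rw [hr, ← sq, inv_mul_cancel₀]
    rw [I_mul_int_sq_sub_one]
    exact neg_ne_zero.2 (int_sq_add_one_ne_zero j)
  have hdet : (symbolDiag n symbolR1 J).det ^ 2
      = (-1) ^ n * (symbolDiag n symbolR J).det := by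
    rw [det_symbolDiag, det_symbolDiag, Finset.prod_congr rfl fun j _ => hr' j,
      Finset.prod_mul_distrib, prod_Icc_inv_add_one, ← Finset.prod_congr rfl fun j _ => hs j,
      ← pow_mul, mul_comm n 2, pow_mul, ← mul_pow]
    ring
  have h1 : (1 - firstOrderTrunc A₁ A₀ B₀ lam J).det
      = (1 - Matrix.reindex (Equiv.prodSumDistrib _ _ _) (Equiv.prodSumDistrib _ _ _)
        (firstOrderTrunc A₁ A₀ B₀ lam J)).det := by
    rw [← Matrix.det_reindex_self (Equiv.prodSumDistrib (Modes J) (Fin n) (Fin n))]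
    congr 1
    ext p q
    simp [Matrix.one_apply]
  rw [h1, firstOrderTrunc_reindex, det_one_sub_firstOrder hS, secondOrderTrunc_eq,
    det_one_sub_secondOrder hQ, hdet, mul_assoc]

/-- Only the even part of `1 / (ij - 1)` contributes to the symmetric sum. -/
theorem trace_firstOrderTrunc (A₁ A₀ B₀ : Matrix (Fin n) (Fin n) L2) (lam : ℂ) (J : ℕ) :
    (firstOrderTrunc A₁ A₀ B₀ lam J).trace
      = (coeffMat A₁ 0 + (2 : ℂ) • (1 : Matrix (Fin n) (Fin n) ℂ)).trace *
        ∑ j ∈ Finset.Icc (-(J : ℤ)) J, 1 / ((j : ℂ) ^ 2 + 1) := by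
  have h : (firstOrderTrunc A₁ A₀ B₀ lam J).trace
      = ∑ j ∈ Finset.Icc (-(J : ℤ)) J, 1 / (Complex.I * (j : ℂ) - 1) *
        -(coeffMat A₁ 0 + (2 : ℂ) • (1 : Matrix (Fin n) (Fin n) ℂ)).trace := by
    rw [Matrix.trace, Fintype.sum_prod_type, ← Finset.sum_coe_sort (Finset.Icc (-(J : ℤ)) J)
      fun j => 1 / (Complex.I * (j : ℂ) - 1) *
        -(coeffMat A₁ 0 + (2 : ℂ) • (1 : Matrix (Fin n) (Fin n) ℂ)).trace]
    refine Finset.sum_congr rfl fun j _ => ?_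
    simp only [Matrix.diag, firstOrderTrunc, Matrix.of_apply, ← Finset.mul_sum, sub_self, if_true]
    congr 1
    rw [Fintype.sum_sum_type]
    simp [systemCoeff, Matrix.trace, Finset.sum_add_distrib]
    ring
  rw [h, ← Finset.sum_mul, sum_Icc_inv_sub_one]
  ring

/-- The contribution of `A₁` vanishes, because the symbol of `∂ₓ (∂ₓ² - 1)⁻¹` is odd. -/
theorem trace_secondOrderTrunc (A₁ A₀ B₀ : Matrix (Fin n) (Fin n) L2) (lam : ℂ) (J : ℕ) :
    (secondOrderTrunc A₁ A₀ B₀ lam J).trace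
      = (coeffMat A₀ 0 + 1 - lam • coeffMat B₀ 0).trace *
        ∑ j ∈ Finset.Icc (-(J : ℤ)) J, 1 / ((j : ℂ) ^ 2 + 1) := by
  have h : (secondOrderTrunc A₁ A₀ B₀ lam J).trace
      = ∑ j ∈ Finset.Icc (-(J : ℤ)) J, (-(symbolDR j * (coeffMat A₁ 0).trace)
        - symbolR j * (coeffMat A₀ 0 + 1 - lam • coeffMat B₀ 0).trace) := by
    rw [Matrix.trace, Fintype.sum_prod_type, ← Finset.sum_coe_sort (Finset.Icc (-(J : ℤ)) J)
      fun j => -(symbolDR j * (coeffMat A₁ 0).trace)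
        - symbolR j * (coeffMat A₀ 0 + 1 - lam • coeffMat B₀ 0).trace]
    refine Finset.sum_congr rfl fun j _ => ?_
    simp only [Matrix.diag, secondOrderTrunc_apply, sub_self, if_true, Finset.sum_sub_distrib,
      Finset.sum_neg_distrib, ← Finset.mul_sum]
    simp [Matrix.trace, Finset.sum_add_distrib, Finset.mul_sum]
  rw [h, Finset.sum_sub_distrib, Finset.sum_neg_distrib, ← Finset.sum_mul, ← Finset.sum_mul,
    sum_Icc_symbolDR]
  simp only [symbolR_apply, Finset.sum_neg_distrib]
  ring

/-- The relation between the Evans functions holds exactly for every truncation. -/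
theorem evansFTrunc_eq (A₁ A₀ B₀ : Matrix (Fin n) (Fin n) L2) (lam : ℂ) (J : ℕ) :
    evansFTrunc A₁ A₀ B₀ lam J = epsilonTrunc n J *
      Complex.exp ((firstOrderTrunc A₁ A₀ B₀ lam J).trace
        - (secondOrderTrunc A₁ A₀ B₀ lam J).trace) *
      matDet2 (secondOrderTrunc A₁ A₀ B₀ lam J) := by
  rw [evansFTrunc, finiteDet2_toLin', matDet2, matDet2, det_one_sub_firstOrderTrunc,
    epsilonTrunc_eq, Complex.exp_sub]
  have := Complex.exp_ne_zero (secondOrderTrunc A₁ A₀ B₀ lam J).trace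
  field_simp

theorem isHilbertSchmidt_birmanSchwinger (A₁ A₀ B₀ : Matrix (Fin n) (Fin n) L2) (lam : ℂ) :
    IsHilbertSchmidt (birmanSchwinger A₁ A₀ B₀ lam) := by
  refine ⟨_, vecBasis (Fin n), ?_⟩
  refine (((summable_norm_sq_vecOp symbolDR A₁).mul_left 2).add ((summable_norm_sq_vecOp symbolR
    (A₀ + oneMat n - lam • B₀)).mul_left 2)).of_nonneg_of_le (fun _ => by positivity) fun q => ?_
  rw [birmanSchwinger, sub_apply, neg_apply,
    sub_eq_add_neg, ← neg_add, norm_neg]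
  exact norm_sq_add_le _ _

theorem tendsto_evansFTrunc (A₁ A₀ B₀ : Matrix (Fin n) (Fin n) L2) (lam : ℂ) :
    Tendsto (evansFTrunc A₁ A₀ B₀ lam) atTop (𝓝 (epsilon n *
      Complex.exp (deltaHat A₁ - delta A₀ B₀ lam) * evansD A₁ A₀ B₀ lam)) := by
  have hD : Tendsto (fun J => matDet2 (secondOrderTrunc A₁ A₀ B₀ lam J)) atTop
      (𝓝 (evansD A₁ A₀ B₀ lam)) :=
    (isHilbertSchmidt_birmanSchwinger A₁ A₀ B₀ lam).hasDet2_det2.tendsto_fourier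
  have h1 : Tendsto (fun J => (firstOrderTrunc A₁ A₀ B₀ lam J).trace) atTop
      (𝓝 (deltaHat A₁)) := by
    simp only [trace_firstOrderTrunc]
    rw [deltaHat, one_add_tsum_inv_sq_add_I_mul]
    exact (tendsto_sum_Icc summable_inv_sq_add_one).const_mul _
  have h2 : Tendsto (fun J => (secondOrderTrunc A₁ A₀ B₀ lam J).trace) atTop
      (𝓝 (delta A₀ B₀ lam)) := by
    simp only [trace_secondOrderTrunc]
    exact (tendsto_sum_Icc summable_inv_sq_add_one).const_mul _
  refine (((tendsto_epsilonTrunc n).mul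
    ((Complex.continuous_exp.tendsto _).comp (h1.sub h2))).mul hD).congr fun J => ?_
  exact (evansFTrunc_eq A₁ A₀ B₀ lam J).symm

/-- When `A₁` has the derivative `A₁'` in `L²`, the truncations defining `F` are Galerkin
approximations of `𝕂(λ)`. -/
theorem inner_firstOrderBS {A₁ A₁' : Matrix (Fin n) (Fin n) L2} (h : IsWeakDeriv A₁ A₁')
    (A₀ B₀ : Matrix (Fin n) (Fin n) L2) (lam : ℂ) (J : ℕ) :
    (Matrix.of fun p q : Finset.Icc (-(J : ℤ)) J × (Fin n ⊕ Fin n) =>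
      inner ℂ (vecBasis (Fin n ⊕ Fin n) ((p.1 : ℤ), p.2))
        (firstOrderBS A₁ A₁' A₀ B₀ lam (vecBasis (Fin n ⊕ Fin n) ((q.1 : ℤ), q.2))))
      = firstOrderTrunc A₁ A₀ B₀ lam J := by
  have hs (j : ℤ) : symbolR1 j = 1 / (Complex.I * j - 1) := rfl
  ext ⟨⟨j, hj⟩, a⟩ ⟨⟨k, hk⟩, b⟩
  rw [Matrix.of_apply, firstOrderBS, inner_vecOp, hs, firstOrderTrunc, Matrix.of_apply]
  congr 1
  have hpq : ((⟨j, hj⟩, a) : Modes J × (Fin n ⊕ Fin n)) = (⟨k, hk⟩, b) ↔ a = b ∧ j - k = 0 := by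
    rw [Prod.ext_iff, Subtype.ext_iff, sub_eq_zero, and_comm]
  simp only [hpq]
  rcases a with a | a <;> rcases b with b | b <;>
    simp only [Matrix.fromBlocks_apply₁₁, Matrix.fromBlocks_apply₁₂, Matrix.fromBlocks_apply₂₁,
      Matrix.fromBlocks_apply₂₂, Matrix.sub_apply, Matrix.neg_apply, Matrix.smul_apply,
      Matrix.zero_apply, fourierCoeff_sub_L2, fourierCoeff_neg_L2, fourierCoeff_smul_L2,
      fourierCoeff_oneMat, h a b, systemCoeff, coeffMat, Matrix.of_apply, smul_eq_mul,
      Sum.inl.injEq, Sum.inr.injEq, reduceCtorEq, false_and, if_false, zero_sub, sub_zero]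
  by_cases hjk : j - k = 0 <;> simp [hjk, Matrix.one_apply]

end Truncation

end PeriodicEvans

theorem corollary5p4 (n : ℕ)
    (A₁ A₀ B₀ : Matrix (Fin n) (Fin n) PeriodicEvans.L2) (lam : ℂ) :
    -- the series and the product in the constants converge
    (Summable fun j : {j : ℤ // j ≠ 0} =>
        1 / (((j : ℤ) : ℂ) ^ 2 + Complex.I * (j : ℤ))) ∧
    (Summable fun j : ℤ => 1 / ((j : ℂ) ^ 2 + 1)) ∧
    Tendsto (PeriodicEvans.epsilonTrunc n) atTop (𝓝 (PeriodicEvans.epsilon n)) ∧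
    -- the determinants exist
    PeriodicEvans.HasDet2 (PeriodicEvans.birmanSchwinger A₁ A₀ B₀ lam)
      (PeriodicEvans.evansD A₁ A₀ B₀ lam) ∧
    Tendsto (PeriodicEvans.evansFTrunc A₁ A₀ B₀ lam) atTop
      (𝓝 (PeriodicEvans.evansF A₁ A₀ B₀ lam)) ∧
    (∀ A₁' : Matrix (Fin n) (Fin n) PeriodicEvans.L2, PeriodicEvans.IsWeakDeriv A₁ A₁' →
      PeriodicEvans.HasDet2 (PeriodicEvans.firstOrderBS A₁ A₁' A₀ B₀ lam)
        (PeriodicEvans.evansF A₁ A₀ B₀ lam)) ∧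
    -- the relation between them
    PeriodicEvans.evansF A₁ A₀ B₀ lam =
      PeriodicEvans.epsilon n *
        Complex.exp (PeriodicEvans.deltaHat A₁ - PeriodicEvans.delta A₀ B₀ lam) *
        PeriodicEvans.evansD A₁ A₀ B₀ lam := by
  have hF := PeriodicEvans.tendsto_evansFTrunc A₁ A₀ B₀ lam
  have hF' : Tendsto (PeriodicEvans.evansFTrunc A₁ A₀ B₀ lam) atTop
      (𝓝 (PeriodicEvans.evansF A₁ A₀ B₀ lam)) := tendsto_nhds_limUnder ⟨_, hF⟩
  refine ⟨PeriodicEvans.summable_inv_sq_add_I_mul.subtype _,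
    PeriodicEvans.summable_inv_sq_add_one, PeriodicEvans.tendsto_epsilonTrunc n,
    (PeriodicEvans.isHilbertSchmidt_birmanSchwinger A₁ A₀ B₀ lam).hasDet2_det2, hF',
    fun A₁' hA => ?_, tendsto_nhds_unique hF' hF⟩
  obtain ⟨d, hd⟩ := (PeriodicEvans.isHilbertSchmidt_vecOp PeriodicEvans.symbolR1 (Matrix.fromBlocks
    (-PeriodicEvans.oneMat n) (PeriodicEvans.oneMat n) (lam • B₀ - A₀ - A₁')
    (-A₁ - PeriodicEvans.oneMat n))).exists_hasDet2
  have hlim := hd.tendsto_fourier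
  have hFd : Tendsto (PeriodicEvans.evansFTrunc A₁ A₀ B₀ lam) atTop (𝓝 d) := by
    refine hlim.congr fun J => ?_
    rw [PeriodicEvans.evansFTrunc, PeriodicEvans.finiteDet2_toLin',
      ← PeriodicEvans.inner_firstOrderBS hA]
    rfl
  rw [tendsto_nhds_unique hF' hFd]
  exact hd
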